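/- Let $q$ be a prime power, let $\mathbf F_q$ be the field with $q$ elements, and let $t\ge 1$ be an integer. For a polynomial $\phi\in\mathbf F_q[z]$ of degree $d$ with $\phi(0)\neq 0$, its conjugate is $\phi^*(z)=\phi(0)^{-1}z^{d}\phi(z^{-1})$. Let $N^*(q;j)$ be the number of monic irreducible polynomials $\phi$ of degree $j$ over $\mathbf F_q$ with $\phi(0)\ne 0$ and $\phi=\phi^*$, and let $M^*(q;j)$ be the number of unordered pairs $\{\phi,\phi^*\}$ of monic irreducible polynomials of degree $j$ over $\mathbf F_q$ with $\phi(0)\neq 0$ and $\phi\ne\phi^*$. Put $e=2$ if $q$ is odd and $e=1$ if $q$ is even, and let \[ P(q,t)=\prod_{i\ge 1}\left(1-\frac1{q^{2i-1}}\right)^{e}\ \prod_{1\le j\le t/2}\ \prod_{i\ge 1}\left(1+\frac{(-1)^i}{q^{ij}}\right)^{N^*(q;2j)}\ \prod_{1\le j\le t}\ \prod_{i\ge 1}\left(1-\frac{1}{q^{ij}}\right)^{M^*(q;j)} . \] **Theorem.** For odd $q$, and likewise for even $q$, the following hold. 1. For fixed $t\ge1$ and $q$, the proportion of elements of $\mathrm{Sp}_{2n}(q)$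 whose characteristic polynomial has no irreducible factor over $\mathbf F_q$ of degree at most $t$ tends to $P(q,t)$ as $n\to\infty$. 2. $P(q,t)$ is uniformly bounded away from $1$: there is a constant $C<1$ such that $P(q,t)\le C$ for all $t\ge 1$ and all $q$. 3. For fixed $t\ge1$, $P(q,t)$ is bounded away from $0$ uniformly in $q$: there is a constant $c=c(t)>0$ such that $P(q,t)\ge c$ for all $q$. -/

import Mathlib

open Filter Topology Polynomial

universe u

noncomputable section

/-- The conjugate `φ*(z) = φ(0)⁻¹ z ^ (deg φ) φ(1/z)` of a polynomial `φ` with non-zero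
constant term. -/
def conjPoly {F : Type u} [Field F] (φ : F[X]) : F[X] :=
  C (φ.coeff 0)⁻¹ * φ.reverse

/-- `N*(q; j)`: the number of monic irreducible self-conjugate polynomials of degree `j`
(with non-zero constant term) over the field `F` with `q` elements. -/
def numSelfConj (F : Type u) [Field F] (j : ℕ) : ℕ :=
  Set.ncard {φ : F[X] | φ.Monic ∧ Irreducible φ ∧ φ.coeff 0 ≠ 0 ∧ φ.natDegree = j ∧
    conjPoly φ = φ}

/-- `M*(q; j)`: the number of unordered conjugate pairs `{φ, φ*}` of monic irreducible
non-self-conjugate polynomials of degree `j` (with non-zero constant term) over the field `F`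
with `q` elements. -/
def numConjPairs (F : Type u) [Field F] (j : ℕ) : ℕ :=
  Set.ncard {s : Sym2 F[X] | ∃ φ : F[X], φ.Monic ∧ Irreducible φ ∧ φ.coeff 0 ≠ 0 ∧
    φ.natDegree = j ∧ conjPoly φ ≠ φ ∧ s = s(φ, conjPoly φ)}

/-- `f` has no (irreducible) factor of degree at most `t`. -/
def HasNoSmallFactor {F : Type u} [Field F] (t : ℕ) (f : F[X]) : Prop :=
  ∀ φ : F[X], Irreducible φ → φ ∣ f → t < φ.natDegree

/-- The proportion of elements of `Sp_{2n}(F)` whose characteristic polynomial has no factor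
of degree at most `t`. -/
def spProportion (F : Type u) [Field F] (t n : ℕ) : ℝ :=
  (Nat.card {A : Matrix.symplecticGroup (Fin n) F //
      HasNoSmallFactor t (A : Matrix (Fin n ⊕ Fin n) (Fin n ⊕ Fin n) F).charpoly} : ℝ) /
    (Nat.card (Matrix.symplecticGroup (Fin n) F) : ℝ)

/-- With `q = |F|`, the product
`∏_{i ≥ 1} (1 - 1/q^(2i-1))^e * ∏_{1 ≤ j ≤ t/2} ∏_{i ≥ 1} (1 + (-1)^i / q^(ij))^{N*(q;2j)}
  * ∏_{1 ≤ j ≤ t} ∏_{i ≥ 1} (1 - 1/q^(ij))^{M*(q;j)}`.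
The index `i ≥ 1` is written as `i + 1` with `i : ℕ`. -/
def spLimit (e : ℕ) (F : Type u) [Field F] (t : ℕ) : ℝ :=
  (∏' i : ℕ, (1 - 1 / (Nat.card F : ℝ) ^ (2 * i + 1)) ^ e) *
  (∏ j ∈ Finset.Icc 1 (t / 2), ∏' i : ℕ,
    (1 + (-1) ^ (i + 1) / (Nat.card F : ℝ) ^ ((i + 1) * j)) ^ numSelfConj F (2 * j)) *
  (∏ j ∈ Finset.Icc 1 t, ∏' i : ℕ,
    (1 - 1 / (Nat.card F : ℝ) ^ ((i + 1) * j)) ^ numConjPairs F j)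

/-- Convergence of the infinite products in `spLimit`. -/
theorem multipliable_spLimit_aux (q : ℝ) (hq : 1 < q) (a : ℕ → ℝ) (ha : ∀ i, |a i| ≤ 1)
    (k : ℕ → ℕ) (hk : ∀ i, i ≤ k i) (e : ℕ) :
    Multipliable fun i : ℕ => (1 + a i / q ^ k i) ^ e := by
  refine Multipliable.pow (f := fun i : ℕ => 1 + a i / q ^ k i) ?_ e
  refine Real.multipliable_one_add_of_summable ?_
  have hs : Summable fun i : ℕ => (q⁻¹) ^ i :=
    summable_geometric_of_lt_one (by positivity) (inv_lt_one_of_one_lt₀ hq)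
  refine Summable.of_norm_bounded hs fun i => ?_
  have hq0 : 0 < q := by linarith
  rw [Real.norm_eq_abs, abs_div, abs_of_pos (pow_pos hq0 (k i)), inv_pow, ← one_div]
  exact div_le_div₀ zero_le_one (ha i) (pow_pos hq0 i) (pow_le_pow_right₀ hq.le (hk i))

theorem multipliable_spLimit_one (F : Type u) [Field F] [Finite F] (e : ℕ) :
    Multipliable fun i : ℕ => (1 - 1 / (Nat.card F : ℝ) ^ (2 * i + 1)) ^ e := by
  have h := multipliable_spLimit_aux (Nat.card F : ℝ) (by exact_mod_cast Finite.one_lt_card)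
    (fun _ => -1) (by simp) (fun i => 2 * i + 1) (fun i => by omega) e
  simpa [sub_eq_add_neg, neg_div] using h

theorem multipliable_spLimit_two (F : Type u) [Field F] [Finite F] (j e : ℕ) (hj : 1 ≤ j) :
    Multipliable fun i : ℕ =>
      (1 + (-1) ^ (i + 1) / (Nat.card F : ℝ) ^ ((i + 1) * j)) ^ e :=
  multipliable_spLimit_aux (Nat.card F : ℝ) (by exact_mod_cast Finite.one_lt_card)
    (fun i => (-1) ^ (i + 1)) (by simp) (fun i => (i + 1) * j) (fun i => by nlinarith) e

theorem multipliable_spLimit_three (F : Type u) [Field F] [Finite F] (j e : ℕ) (hj : 1 ≤ j) :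
    Multipliable fun i : ℕ => (1 - 1 / (Nat.card F : ℝ) ^ ((i + 1) * j)) ^ e := by
  have h := multipliable_spLimit_aux (Nat.card F : ℝ) (by exact_mod_cast Finite.one_lt_card)
    (fun _ => -1) (by simp) (fun i => (i + 1) * j) (fun i => by nlinarith) e
  simpa [sub_eq_add_neg, neg_div] using h

end

/-! Let `S` consist of the self-conjugate monic irreducibles of degree at most `t` and one member of
each conjugate pair, with `X` excluded. The characteristic polynomial of an isometry `T` has no
factor of degree at most `t` exactly when `φ(T)` is injective for every `φ` in `S`: `X` never
divides it because `det T` is a unit, and `φ(T)` is singular iff its conjugate is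
(`hasNoSmallFactor_iff`, `ker_aeval_conjPoly_ne_bot`).

For a family `d` of multiplicities, let `E_d` be the sum over `S` of the modules `(F[X]/φ)^(d φ)`.
The injective module maps from `E_d` to `(V, T)` are counted by independent tuples in the kernels of
the `φ(T)`, so a q-binomial inversion writes the indicator of "all kernels vanish" as a sum over `d`
of explicit weights times these counts (`sum_piFinset_card_intertwiners`). Now average over `T`. By
Witt's theorem, for a fixed invariant alternating form on `E_d`, the pairs `(T, f)` with `f` pulling
the symplectic form back to it number either zero or exactly `|Sp|` (`card_isometry_intertwining`).
So the proportion is exactly the weighted sum over `d` of the number of invariant alternating forms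
on `E_d` that embed in `V`. Every such form embeds once `dim E_d ≤ n`, and dominated convergence
replaces the embedded forms by all forms (`tendsto_proportion_ker_eq_bot`).

Components of non-conjugate type are orthogonal, so the limiting sum is a product of one series per
element of `S`. With `Q = |F[X]/φ|`, the number of forms on `(F[X]/φ)^d` is `1` if `φ` is not
self-conjugate, and otherwise `Q^(d choose 2)` times `1` (degree one) or `Q^(d/2)` (even degree).
Euler's two q-exponential identities sum the three series to the three kinds of factor of `P(q,t)`;
the exponent `e` is the number of square roots of `1` in `F`.

The bound away from `1` comes from degree one alone: `e + M*(q;1) ≥ q/2` factors are at most `1 -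
1/q`, and all others are at most `1`. The bound away from `0` holds because each infinite product in
base `Q` is at least `exp(-4/Q)` and is raised to a power at most a constant times `Q`. -/

noncomputable section

/-! ### Witt's extension theorem and double counting of isometries. -/

section Isometries

variable {F : Type u} [Field F] {V : Type u} [AddCommGroup V] [Module F V]

/-- The set of isometric embeddings of `(E, β)` into `(V, B)`. -/
def IsometricEmb {E : Type u} [AddCommGroup E] [Module F E] (β : LinearMap.BilinForm F E)
    (B : LinearMap.BilinForm F V) : Set (E →ₗ[F] V) :=
  {f | Function.Injective f ∧ ∀ x y, B (f x) (f y) = β x y}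

/-- The linear endomorphisms preserving a bilinear form. -/
def IsometrySet (B : LinearMap.BilinForm F V) : Set (V →ₗ[F] V) :=
  {T | ∀ x y, B (T x) (T y) = B x y}

variable {B : LinearMap.BilinForm F V}

theorem IsometrySet.comp_mem {R T : V →ₗ[F] V} (hR : R ∈ IsometrySet B)
    (hT : T ∈ IsometrySet B) : R ∘ₗ T ∈ IsometrySet B := fun x y => by
  rw [LinearMap.comp_apply, LinearMap.comp_apply, hR, hT]

theorem IsometrySet.injective (hB : Function.Injective B) {T : V →ₗ[F] V}
    (hT : T ∈ IsometrySet B) : Function.Injective T := by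
  rw [← LinearMap.ker_eq_bot, LinearMap.ker_eq_bot']
  intro x hx
  refine hB (LinearMap.ext fun y => ?_)
  rw [← hT, hx, map_zero, LinearMap.zero_apply, LinearMap.zero_apply]

theorem IsometricEmb.isometry_comp {E : Type u} [AddCommGroup E] [Module F E]
    {β : LinearMap.BilinForm F E} (hB : Function.Injective B) {f : E →ₗ[F] V}
    (hf : f ∈ IsometricEmb β B) {T : V →ₗ[F] V} (hT : T ∈ IsometrySet B) :
    T ∘ₗ f ∈ IsometricEmb β B :=
  ⟨(IsometrySet.injective hB hT).comp hf.1, fun x y => by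
    rw [LinearMap.comp_apply, LinearMap.comp_apply, hT, hf.2]⟩

variable [FiniteDimensional F V]

theorem surjective_dualMap_comp_of_injective {E : Type u} [AddCommGroup E] [Module F E]
    (hB : Function.Injective B) {f : E →ₗ[F] V} (hf : Function.Injective f) :
    Function.Surjective (f.dualMap ∘ₗ B) := by
  rw [LinearMap.coe_comp]
  refine (LinearMap.dualMap_surjective_of_injective hf).comp ?_
  exact (LinearMap.injective_iff_surjective_of_finrank_eq_finrank
    (Subspace.dual_finrank_eq (K := F) (V := V)).symm).1 hB

theorem finrank_ker_dualMap_comp {E : Type u} [AddCommGroup E] [Module F E]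
    (hB : Function.Injective B) {f : E →ₗ[F] V} (hf : Function.Injective f) :
    Module.finrank F (LinearMap.ker (f.dualMap ∘ₗ B)) + Module.finrank F E =
      Module.finrank F V := by
  have : FiniteDimensional F E := FiniteDimensional.of_injective f hf
  have h := LinearMap.finrank_range_add_finrank_ker (f.dualMap ∘ₗ B)
  rw [LinearMap.range_eq_top.2 (surjective_dualMap_comp_of_injective hB hf), finrank_top,
    Subspace.dual_finrank_eq] at h
  omega

/-- One step of Witt extension. Nondegeneracy gives a `w` with the right pairings, free up to the
orthogonal of the image of `g`. If every choice lies in that image, the orthogonal lies there too,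
hence inside the image under `g` of the radical of `β`. Comparing dimensions, the orthogonal of the
image of `f` is the image under `f` of the radical, which puts `v` in the range of `f`. -/
theorem exists_notMem_range_of_isometricEmb {E : Type u} [AddCommGroup E] [Module F E]
    (hB : Function.Injective B)
    {β : LinearMap.BilinForm F E} {f g : E →ₗ[F] V}
    (hf : f ∈ IsometricEmb β B) (hg : g ∈ IsometricEmb β B)
    {v : V} (hv : v ∉ LinearMap.range f) :
    ∃ w, w ∉ LinearMap.range g ∧ ∀ e, B w (g e) = B v (f e) := by
  have : FiniteDimensional F E := FiniteDimensional.of_injective f hf.1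
  obtain ⟨w, hw⟩ := surjective_dualMap_comp_of_injective hB hg.1 ((f.dualMap ∘ₗ B) v)
  have hw' : ∀ e, B w (g e) = B v (f e) := fun e => by
    simpa using DFunLike.congr_fun hw e
  by_cases hwr : w ∈ LinearMap.range g
  swap
  · exact ⟨w, hwr, hw'⟩
  by_cases hz : LinearMap.ker (g.dualMap ∘ₗ B) ≤ LinearMap.range g
  swap
  · obtain ⟨z, hz1, hz2⟩ := SetLike.not_le_iff_exists.1 hz
    refine ⟨w + z, fun h => hz2 ?_, fun e => ?_⟩
    · simpa using (LinearMap.range g).sub_mem h hwr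
    · have : B z (g e) = 0 := by
        simpa using DFunLike.congr_fun (LinearMap.mem_ker.1 hz1) e
      simp [hw', this]
  exfalso
  obtain ⟨e₀, rfl⟩ := hwr
  have hmap : LinearMap.ker (g.dualMap ∘ₗ B) ≤ (LinearMap.ker β).map g := by
    intro z h
    obtain ⟨e, rfl⟩ := hz h
    refine ⟨e, ?_, rfl⟩
    rw [SetLike.mem_coe, LinearMap.mem_ker]
    ext e'
    rw [← hg.2]
    simpa using DFunLike.congr_fun (LinearMap.mem_ker.1 h) e'
  have hmap' : (LinearMap.ker β).map f ≤ LinearMap.ker (f.dualMap ∘ₗ B) := by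
    rintro _ ⟨e, he, rfl⟩
    rw [LinearMap.mem_ker]
    ext e'
    have := DFunLike.congr_fun (LinearMap.mem_ker.1 he) e'
    simpa [hf.2] using this
  have h1 := finrank_ker_dualMap_comp hB hf.1
  have h2 := finrank_ker_dualMap_comp hB hg.1
  have h3 := Submodule.finrank_mono hmap
  have h4 := LinearEquiv.finrank_eq ((LinearMap.ker β).equivMapOfInjective g hg.1)
  have h5 := LinearEquiv.finrank_eq ((LinearMap.ker β).equivMapOfInjective f hf.1)
  have h6 := Submodule.eq_of_le_of_finrank_le hmap' (by omega)
  have h7 : v - f e₀ ∈ LinearMap.ker (f.dualMap ∘ₗ B) := by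
    rw [LinearMap.mem_ker]
    ext e
    have := hw' e
    rw [hg.2, ← hf.2] at this
    simp [this]
  rw [← h6] at h7
  obtain ⟨e, -, he⟩ := h7
  exact hv ⟨e + e₀, by rw [map_add, he]; abel⟩

/-- Witt's extension theorem for alternating forms. -/
theorem exists_isometry_comp_eq (hB : Function.Injective B) (hA : B.IsAlt) (k : ℕ) :
    ∀ {E : Type u} [AddCommGroup E] [Module F E] {β : LinearMap.BilinForm F E}
      {f g : E →ₗ[F] V}, f ∈ IsometricEmb β B → g ∈ IsometricEmb β B →
      Module.finrank F V = Module.finrank F E + k → ∃ T ∈ IsometrySet B, T ∘ₗ f = g := by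
  induction k with
  | zero =>
    intro E _ _ β f g hf hg h
    have : FiniteDimensional F E := FiniteDimensional.of_injective f hf.1
    let e := LinearEquiv.ofInjectiveOfFinrankEq f hf.1 h.symm
    have he : ∀ x, e.symm (f x) = x := fun x => e.symm_apply_apply x
    have he' : ∀ x, f (e.symm x) = x := fun x => e.apply_symm_apply x
    refine ⟨g ∘ₗ e.symm.toLinearMap, fun x y => ?_, ?_⟩
    · simp only [LinearMap.comp_apply, LinearEquiv.coe_coe]
      rw [hg.2, ← hf.2, he', he']
    · ext x; simp [he]
  | succ k ih =>
    intro E _ _ β f g hf hg h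
    have : FiniteDimensional F E := FiniteDimensional.of_injective f hf.1
    have hr : ∃ v, v ∉ LinearMap.range f := by
      by_contra! hcon
      have := LinearMap.finrank_range_of_inj hf.1
      rw [(eq_top_iff.2 fun v _ => hcon v : LinearMap.range f = ⊤), finrank_top] at this
      omega
    obtain ⟨v, hv⟩ := hr
    obtain ⟨w, hw, hwv⟩ := exists_notMem_range_of_isometricEmb hB hf hg hv
    have key : ∀ (f : E →ₗ[F] V) (v : V), Function.Injective f → v ∉ LinearMap.range f →
        Function.Injective (f.coprod (LinearMap.toSpanSingleton F V v)) := by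
      intro f v hf hv
      rw [← LinearMap.ker_eq_bot, LinearMap.ker_eq_bot']
      rintro ⟨e, a⟩ h
      simp only [LinearMap.coprod_apply, LinearMap.toSpanSingleton_apply] at h
      have ha : a = 0 := by
        by_contra ha
        refine hv ⟨-a⁻¹ • e, ?_⟩
        rw [map_smul, eq_neg_of_add_eq_zero_left h, neg_smul_neg, smul_smul,
          inv_mul_cancel₀ ha, one_smul]
      subst ha
      simp only [zero_smul, add_zero] at h
      rw [hf (h.trans (map_zero f).symm)]; rfl
    -- Adjoin `v` to `f` and `w` to `g`. The two pulled-back forms agree: mixed pairings match by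
    -- the choice of `w`, and `B v v = B w w = 0` since `B` is alternating.
    obtain ⟨T, hT, hTf⟩ := ih (E := E × F)
      (β := B.compl₁₂ (f.coprod (LinearMap.toSpanSingleton F V v))
        (f.coprod (LinearMap.toSpanSingleton F V v)))
      (f := f.coprod (LinearMap.toSpanSingleton F V v))
      (g := g.coprod (LinearMap.toSpanSingleton F V w))
      ⟨key f v hf.1 hv, fun x y => rfl⟩ ⟨key g w hg.1 hw, fun x y => by
        have hwv' : ∀ e, B (g e) w = B (f e) v := fun e => by
          rw [← hA.neg_eq, hwv, hA.neg_eq]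
        simp [hwv, hwv', hf.2, hg.2, hA.self_eq_zero]⟩
      (by rw [Module.finrank_prod, Module.finrank_self]; omega)
    refine ⟨T, hT, ?_⟩
    ext x
    simpa using DFunLike.congr_fun hTf (x, 0)

theorem IsometricEmb.exists_isometry (hB : Function.Injective B) (hA : B.IsAlt) {E : Type u}
    [AddCommGroup E] [Module F E] {β : LinearMap.BilinForm F E} {f g : E →ₗ[F] V}
    (hf : f ∈ IsometricEmb β B) (hg : g ∈ IsometricEmb β B) :
    ∃ T ∈ IsometrySet B, T ∘ₗ f = g := by
  have := LinearMap.finrank_le_finrank_of_injective hf.1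
  exact exists_isometry_comp_eq hB hA (Module.finrank F V - Module.finrank F E) hf hg (by omega)

variable [Finite F]

theorem finite_linearMap {E : Type u} [AddCommGroup E] [Module F E] [FiniteDimensional F E] :
    Finite (E →ₗ[F] V) := Module.finite_of_finite F

/-- Orbit-stabilizer: isometries permute the embeddings of `β` transitively by Witt, so all fibres
of `T ↦ T ∘ f` have the same size. -/
theorem card_isometry_comp_eq_mul (hB : Function.Injective B) (hA : B.IsAlt) {E : Type u}
    [AddCommGroup E] [Module F E] {β : LinearMap.BilinForm F E} {f g : E →ₗ[F] V}
    (hf : f ∈ IsometricEmb β B) (hg : g ∈ IsometricEmb β B) :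
    Nat.card (IsometricEmb β B) *
      Nat.card {T : V →ₗ[F] V // T ∈ IsometrySet B ∧ T ∘ₗ f = g} =
        Nat.card (IsometrySet B) := by
  have : FiniteDimensional F E := FiniteDimensional.of_injective f hf.1
  have : Finite (E →ₗ[F] V) := finite_linearMap
  have : Finite (V →ₗ[F] V) := finite_linearMap
  have hle : ∀ g₁ ∈ IsometricEmb β B, ∀ g₂ ∈ IsometricEmb β B,
      Nat.card {T : V →ₗ[F] V // T ∈ IsometrySet B ∧ T ∘ₗ f = g₁} ≤
        Nat.card {T : V →ₗ[F] V // T ∈ IsometrySet B ∧ T ∘ₗ f = g₂} := by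
    intro g₁ h₁ g₂ h₂
    obtain ⟨R, hR, hRg⟩ := IsometricEmb.exists_isometry hB hA h₁ h₂
    refine Nat.card_le_card_of_injective
      (fun T => ⟨R ∘ₗ T.1, IsometrySet.comp_mem hR T.2.1, by
        rw [LinearMap.comp_assoc, T.2.2, hRg]⟩) ?_
    rintro ⟨T, hT⟩ ⟨T', hT'⟩ h
    simp only [Subtype.mk.injEq] at h ⊢
    ext x
    exact IsometrySet.injective hB hR (DFunLike.congr_fun h x)
  have he := Nat.card_congr (Equiv.sigmaFiberEquiv
    (fun T : IsometrySet B => (⟨T.1 ∘ₗ f, IsometricEmb.isometry_comp hB hf T.2⟩ : IsometricEmb β B)))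
  have := Fintype.ofFinite (IsometricEmb β B)
  rw [Nat.card_sigma] at he
  rw [← he, Nat.card_eq_fintype_card (α := IsometricEmb β B), ← Finset.card_univ, ← smul_eq_mul,
    ← Finset.sum_const]
  refine Finset.sum_congr rfl fun g' _ => ?_
  rw [le_antisymm (hle g hg g'.1 g'.2) (hle g'.1 g'.2 g hg)]
  refine Nat.card_congr ?_
  exact { toFun := fun T => ⟨⟨T.1, T.2.1⟩, Subtype.ext T.2.2⟩
          invFun := fun T => ⟨T.1.1, T.1.2, congrArg Subtype.val T.2⟩
          left_inv := fun T => rfl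
          right_inv := fun T => rfl }

/-- The alternating bilinear forms preserved by an endomorphism. -/
def InvAltForms {E : Type*} [AddCommGroup E] [Module F E] (X : E →ₗ[F] E) :
    Set (LinearMap.BilinForm F E) :=
  {β | β.IsAlt ∧ ∀ x y, β (X x) (X y) = β x y}

/-- Summing over all isometries `T` the number of embeddings `f` with `T f = f X` amounts to
counting the `X`-invariant alternating forms that embed isometrically. -/
theorem card_isometry_intertwining (hB : Function.Injective B) (hA : B.IsAlt) {E : Type u}
    [AddCommGroup E] [Module F E] [FiniteDimensional F E] {X : E →ₗ[F] E}
    (hX : Function.Injective X) :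
    Nat.card (Σ T : IsometrySet B, {f : E →ₗ[F] V // Function.Injective f ∧ T.1 ∘ₗ f = f ∘ₗ X}) =
      Nat.card {β : LinearMap.BilinForm F E // β ∈ InvAltForms X ∧ (IsometricEmb β B).Nonempty} *
        Nat.card (IsometrySet B) := by
  have : Finite (E →ₗ[F] V) := finite_linearMap
  have : Finite (V →ₗ[F] V) := finite_linearMap
  have : Finite (LinearMap.BilinForm F E) := Module.finite_of_finite F
  have := Fintype.ofFinite
    {β : LinearMap.BilinForm F E // β ∈ InvAltForms X ∧ (IsometricEmb β B).Nonempty}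
  -- Sort the pairs `(T, f)` by the form that `f` pulls back from `B`; it is `X`-invariant because
  -- `T f = f X` and `T` preserves `B`.
  let e : (Σ β : {β : LinearMap.BilinForm F E // β ∈ InvAltForms X ∧ (IsometricEmb β B).Nonempty},
      Σ f : IsometricEmb β.1 B, {T : V →ₗ[F] V // T ∈ IsometrySet B ∧ T ∘ₗ f.1 = f.1 ∘ₗ X}) →
      (Σ T : IsometrySet B, {f : E →ₗ[F] V // Function.Injective f ∧ T.1 ∘ₗ f = f ∘ₗ X}) :=
    fun p => ⟨⟨p.2.2.1, p.2.2.2.1⟩, ⟨p.2.1.1, p.2.1.2.1, p.2.2.2.2⟩⟩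
  have he : Function.Bijective e := by
    constructor
    · rintro ⟨⟨β, hβ⟩, ⟨f, hf⟩, ⟨T, hT⟩⟩ ⟨⟨β', hβ'⟩, ⟨f', hf'⟩, ⟨T', hT'⟩⟩ h
      simp only [e, Sigma.mk.injEq, Subtype.mk.injEq] at h
      obtain ⟨rfl, h⟩ := h
      have h := congrArg Subtype.val (eq_of_heq h)
      dsimp only at h
      subst h
      obtain rfl : β = β' := by
        ext x y
        rw [← hf.2, ← hf'.2]
      rfl
    · rintro ⟨⟨T, hT⟩, ⟨f, hf, hTf⟩⟩
      refine ⟨⟨⟨B.compl₁₂ f f, ⟨fun x => hA _, fun x y => ?_⟩, ⟨f, hf, fun x y => rfl⟩⟩,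
        ⟨f, hf, fun x y => rfl⟩, ⟨T, hT, hTf⟩⟩, rfl⟩
      have h1 : ∀ x, f (X x) = T (f x) := fun x => (DFunLike.congr_fun hTf x).symm
      rw [LinearMap.compl₁₂_apply, LinearMap.compl₁₂_apply, h1, h1, hT]
  rw [← Nat.card_eq_of_bijective e he, Nat.card_sigma,
    Nat.card_eq_fintype_card (α := {β : LinearMap.BilinForm F E // _}), ← Finset.card_univ,
    ← smul_eq_mul, ← Finset.sum_const]
  refine Finset.sum_congr rfl fun β _ => ?_
  obtain ⟨f₀, hf₀⟩ := β.2.2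
  -- Since `f ∘ X` is another embedding of the same form, the `T` with `T f = f X` form one fibre of
  -- the orbit map. Summed over all embeddings of `β`, the fibres give the whole isometry set once.
  have hfX : ∀ f ∈ IsometricEmb β.1 B, f ∘ₗ X ∈ IsometricEmb β.1 B := fun f hf =>
    ⟨hf.1.comp hX, fun x y => by
      rw [LinearMap.comp_apply, LinearMap.comp_apply, hf.2, β.2.1.2]⟩
  have hpos : 0 < Nat.card (IsometricEmb β.1 B) :=
    Nat.card_pos_iff.2 ⟨⟨⟨f₀, hf₀⟩⟩, inferInstance⟩
  have := Fintype.ofFinite (IsometricEmb β.1 B)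
  rw [Nat.card_sigma, Finset.sum_congr rfl (fun f _ => Nat.eq_of_mul_eq_mul_left hpos
    ((card_isometry_comp_eq_mul hB hA f.2 (hfX f.1 f.2)).trans
      (card_isometry_comp_eq_mul hB hA hf₀ (hfX f₀ hf₀)).symm)), Finset.sum_const, smul_eq_mul,
    Finset.card_univ, ← Nat.card_eq_fintype_card,
    card_isometry_comp_eq_mul hB hA hf₀ (hfX f₀ hf₀)]

end Isometries

/-! ### The standard symplectic space contains every small alternating space. -/

section StandardForm

variable (F : Type u) [Field F] (n : ℕ)

/-- The standard symplectic form. -/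
def standardForm : LinearMap.BilinForm F (Fin n ⊕ Fin n → F) :=
  Matrix.toBilin' (Matrix.J (Fin n) F)

theorem standardForm_apply (u v : Fin n ⊕ Fin n → F) : standardForm F n u v =
    ∑ i, (u (Sum.inr i) * v (Sum.inl i) - u (Sum.inl i) * v (Sum.inr i)) := by
  rw [standardForm, Matrix.toBilin'_apply', Matrix.J]
  simp [dotProduct, Matrix.mulVec, Fintype.sum_sum_type, Matrix.one_apply, Matrix.fromBlocks,
    Finset.sum_sub_distrib]
  ring

theorem standardForm_isAlt : (standardForm F n).IsAlt := fun u => by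
  rw [standardForm_apply]
  exact Finset.sum_eq_zero fun i _ => by ring

theorem standardForm_injective : Function.Injective (standardForm F n) := by
  rw [← LinearMap.ker_eq_bot, LinearMap.ker_eq_bot']
  intro u hu
  ext i
  rcases i with i | i
  · have := DFunLike.congr_fun hu (Pi.single (Sum.inr i) 1)
    simpa [standardForm_apply, Pi.single_apply] using this
  · have := DFunLike.congr_fun hu (Pi.single (Sum.inl i) 1)
    simpa [standardForm_apply, Pi.single_apply] using this

variable {F n}

/-- The Gram matrix is `U - Uᵀ` with `U` its strictly upper triangular part. Coordinates go into one
half of the symplectic space and the rows of `U` into the other; the first half already ensures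
injectivity, so `β` may be degenerate. -/
theorem isometricEmb_standardForm_nonempty_of_finrank_eq {E : Type u} [AddCommGroup E]
    [Module F E] {β : LinearMap.BilinForm F E} (hβ : β.IsAlt) (b : Module.Basis (Fin n) F E) :
    (IsometricEmb β (standardForm F n)).Nonempty := by
  let l : Fin n → E →ₗ[F] F := fun i =>
    b.constr F fun j => if i < j then β (b i) (b j) else 0
  let f : E →ₗ[F] (Fin n ⊕ Fin n → F) := LinearMap.pi (Sum.elim l b.coord)
  refine ⟨f, fun x y h => b.ext_elem fun i => congrFun h (Sum.inr i), ?_⟩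
  suffices h : (standardForm F n).compl₁₂ f f = β from
    fun x y => DFunLike.congr_fun (DFunLike.congr_fun h x) y
  refine LinearMap.BilinForm.ext_basis b fun i j => ?_
  rw [LinearMap.compl₁₂_apply, standardForm_apply]
  simp only [f, l, LinearMap.pi_apply, Sum.elim_inl, Sum.elim_inr, Module.Basis.constr_basis,
    Module.Basis.coord_apply, Module.Basis.repr_self, Finsupp.single_apply, ite_mul, mul_ite,
    one_mul, mul_one, zero_mul, mul_zero, Finset.sum_sub_distrib, Finset.sum_ite_eq,
    Finset.mem_univ, if_true]
  have hs : (∑ x, if x < j then if i = x then β (b x) (b j) else 0 else 0) =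
      if i < j then β (b i) (b j) else 0 := by
    rw [Finset.sum_eq_single i (fun x _ hx => by simp [hx.symm]) (by simp)]
    simp
  rw [hs]
  rcases lt_trichotomy i j with h | rfl | h
  · simp [h, h.not_gt]
  · simp [hβ.self_eq_zero]
  · simp [h, h.not_gt, hβ.neg_eq]

/-- A zero summand pads the dimension up to exactly `n`. -/
theorem isometricEmb_standardForm_nonempty {E : Type u} [AddCommGroup E] [Module F E]
    [FiniteDimensional F E] {β : LinearMap.BilinForm F E} (hβ : β.IsAlt)
    (hn : Module.finrank F E ≤ n) : (IsometricEmb β (standardForm F n)).Nonempty := by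
  have h : Module.finrank F (E × (Fin (n - Module.finrank F E) → F)) = n := by
    rw [Module.finrank_prod, Module.finrank_fin_fun]; omega
  obtain ⟨f, hf⟩ := isometricEmb_standardForm_nonempty_of_finrank_eq
    (β := β.compl₁₂ (LinearMap.fst F E (Fin (n - Module.finrank F E) → F)) (LinearMap.fst F E _))
    (fun x => hβ _) (Module.finBasisOfFinrankEq F _ h)
  exact ⟨f ∘ₗ LinearMap.inl F _ _, hf.1.comp LinearMap.inl_injective, fun x y => hf.2 _ _⟩

end StandardForm

/-! ### Euler's two q-exponential series. -/

section QSeries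

/-- The product `(Q - 1) (Q ^ 2 - 1) ⋯ (Q ^ k - 1)`. -/
def qFac (Q : ℝ) (k : ℕ) : ℝ := ∏ i ∈ Finset.range k, (Q ^ (i + 1) - 1)

theorem qFac_zero (Q : ℝ) : qFac Q 0 = 1 := Finset.prod_range_zero _

theorem qFac_succ (Q : ℝ) (k : ℕ) : qFac Q (k + 1) = qFac Q k * (Q ^ (k + 1) - 1) :=
  Finset.prod_range_succ _ _

variable {Q : ℝ}

theorem pow_sub_one_pos (hQ : 1 < Q) (k : ℕ) : 0 < Q ^ (k + 1) - 1 :=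
  sub_pos.2 (one_lt_pow₀ hQ (Nat.succ_ne_zero k))

theorem qFac_pos (hQ : 1 < Q) (k : ℕ) : 0 < qFac Q k :=
  Finset.prod_pos fun i _ => pow_sub_one_pos hQ i

theorem tendsto_pow_sub_one_atTop (hQ : 1 < Q) :
    Tendsto (fun k : ℕ => Q ^ (k + 1) - 1) atTop atTop :=
  tendsto_atTop_add_const_right _ _
    ((tendsto_pow_atTop_atTop_of_one_lt hQ).comp (tendsto_add_atTop_nat 1))

theorem summable_inv_qFac (hQ : 1 < Q) (y : ℝ) : Summable fun k => y ^ k / qFac Q k := by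
  rcases eq_or_ne y 0 with rfl | hy
  · refine summable_of_ne_finset_zero (s := {0}) fun k hk => ?_
    rw [zero_pow (by simpa using hk), zero_div]
  refine summable_of_ratio_test_tendsto_lt_one (l := 0) zero_lt_one
    (Eventually.of_forall fun k => div_ne_zero (pow_ne_zero k hy) (qFac_pos hQ k).ne') ?_
  have h : Tendsto (fun k : ℕ => |y| / (Q ^ (k + 1) - 1)) atTop (𝓝 0) :=
    (tendsto_pow_sub_one_atTop hQ).const_div_atTop _
  refine h.congr fun k => ?_
  have h1 := pow_sub_one_pos hQ k
  have h2 := qFac_pos hQ k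
  rw [Real.norm_eq_abs, Real.norm_eq_abs, ← abs_div, ← abs_of_pos h1, ← abs_div]
  congr 1
  rw [qFac_succ]
  field_simp
  ring

/-- Successive terms have ratio of absolute value `|z| / (Q - 1/Q^k)`, which tends to `|z| / Q`. -/
theorem summable_pow_choose_div_qFac (hQ : 1 < Q) {z : ℝ} (hz : |z| < Q) :
    Summable fun k => Q ^ (k.choose 2) * z ^ k / qFac Q k := by
  have hQ0 : 0 < Q := by linarith
  rcases eq_or_ne z 0 with rfl | hz0
  · refine summable_of_ne_finset_zero (s := {0}) fun k hk => ?_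
    rw [zero_pow (by simpa using hk), mul_zero, zero_div]
  refine summable_of_ratio_test_tendsto_lt_one (l := |z| / Q) ((div_lt_one hQ0).2 hz)
    (Eventually.of_forall fun k => div_ne_zero (mul_ne_zero (by positivity) (pow_ne_zero k hz0))
      (qFac_pos hQ k).ne') ?_
  have h : Tendsto (fun k : ℕ => |z| / (Q - 1 / Q ^ k)) atTop (𝓝 (|z| / (Q - 0))) := by
    refine Tendsto.div tendsto_const_nhds (tendsto_const_nhds.sub ?_) (by simpa using hQ0.ne')
    exact (tendsto_pow_atTop_atTop_of_one_lt hQ).const_div_atTop _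
  rw [sub_zero] at h
  refine h.congr fun k => ?_
  have h1 := pow_sub_one_pos hQ k
  have h2 := qFac_pos hQ k
  have h3 : (0 : ℝ) < Q ^ k := by positivity
  have h4 : Q - 1 / Q ^ k = (Q ^ (k + 1) - 1) / Q ^ k := by field_simp; ring
  have h5 : 0 < Q - 1 / Q ^ k := h4 ▸ div_pos h1 h3
  rw [Real.norm_eq_abs, Real.norm_eq_abs, ← abs_div, ← abs_of_pos h5, ← abs_div]
  congr 1
  rw [qFac_succ, h4, Nat.choose_succ_succ' k 1, Nat.choose_one_right, pow_add, pow_succ z]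
  field_simp
  rw [pow_add, mul_div_assoc]

/-- Used for the tail left over when a functional equation relating `z` and `z / Q` is iterated `N`
times. -/
theorem tendsto_tsum_mul_pow_div {a : ℕ → ℝ} (ha0 : a 0 = 1) {z : ℝ} (hQ : 1 < Q)
    (ha : Summable fun k => a k * z ^ k) :
    Tendsto (fun N : ℕ => ∑' k, a k * (z / Q ^ N) ^ k) atTop (𝓝 1) := by
  have hlim : ∑' k, (if k = 0 then (1 : ℝ) else 0) = 1 := tsum_ite_eq 0 _
  rw [← hlim]
  refine tendsto_tsum_of_dominated_convergence ha.norm (fun k => ?_)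
    (Eventually.of_forall fun N k => ?_)
  · split_ifs with hk
    · simp [hk, ha0]
    · have h : Tendsto (fun N : ℕ => z / Q ^ N) atTop (𝓝 0) :=
        (tendsto_pow_atTop_atTop_of_one_lt hQ).const_div_atTop _
      simpa [zero_pow hk] using (h.pow k).const_mul (a k)
  · rw [norm_mul, norm_mul, norm_pow, norm_pow, norm_div]
    gcongr
    refine div_le_self (norm_nonneg _) ?_
    rw [norm_pow, Real.norm_of_nonneg (by linarith)]
    exact one_le_pow₀ hQ.le

/-- In the difference of the two series, `y^k - (y/Q)^k` supplies a factor `Q^k - 1`, which cancels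
the last factor of `qFac Q k` and shifts the index. -/
theorem tsum_inv_qFac_div (hQ : 1 < Q) (y : ℝ) :
    ∑' k, y ^ k / qFac Q k = (1 + y / Q) * ∑' k, (y / Q) ^ k / qFac Q k := by
  have hQ0 : Q ≠ 0 := by linarith
  have h1 := (summable_inv_qFac hQ y)
  have h2 := (summable_inv_qFac hQ (y / Q))
  have h3 : ∑' k, y ^ k / qFac Q k - ∑' k, (y / Q) ^ k / qFac Q k =
      y / Q * ∑' k, (y / Q) ^ k / qFac Q k := by
    rw [← h1.tsum_sub h2, (h1.sub h2).tsum_eq_zero_add, ← tsum_mul_left]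
    simp only [pow_zero, sub_self, zero_add]
    refine tsum_congr fun k => ?_
    have h4 := (pow_sub_one_pos hQ k).ne'
    have h5 := (qFac_pos hQ k).ne'
    rw [qFac_succ, div_pow, div_pow]
    field_simp
    ring
  linear_combination h3

theorem tsum_pow_choose_div_qFac_div (hQ : 1 < Q) {z : ℝ} (hz : |z| < Q) :
    ∑' k, Q ^ (k.choose 2) * (z / Q) ^ k / qFac Q k =
      (1 - z / Q) * ∑' k, Q ^ (k.choose 2) * z ^ k / qFac Q k := by
  have hQ0 : 0 < Q := by linarith
  have h1 := summable_pow_choose_div_qFac hQ hz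
  have h2 : Summable fun k => Q ^ (k.choose 2) * (z / Q) ^ k / qFac Q k := by
    refine summable_pow_choose_div_qFac hQ ?_
    rw [abs_div, abs_of_pos hQ0]
    exact (div_le_self (abs_nonneg _) hQ.le).trans_lt hz
  have h3 : ∑' k, Q ^ (k.choose 2) * z ^ k / qFac Q k -
      ∑' k, Q ^ (k.choose 2) * (z / Q) ^ k / qFac Q k =
      z / Q * ∑' k, Q ^ (k.choose 2) * z ^ k / qFac Q k := by
    rw [← h1.tsum_sub h2, (h1.sub h2).tsum_eq_zero_add, ← tsum_mul_left]
    simp only [pow_zero, sub_self, zero_add]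
    refine tsum_congr fun k => ?_
    have h4 := (pow_sub_one_pos hQ k).ne'
    have h5 := (qFac_pos hQ k).ne'
    rw [qFac_succ, div_pow, Nat.choose_succ_succ' k 1, Nat.choose_one_right, pow_add]
    field_simp
    ring
  linear_combination -h3

theorem multipliable_one_add_div_pow (hQ : 1 < Q) (a : ℝ) :
    Multipliable fun i : ℕ => 1 + a / Q ^ (i + 1) := by
  refine Real.multipliable_one_add_of_summable ?_
  have hs : Summable fun i : ℕ => (Q⁻¹) ^ i :=
    summable_geometric_of_lt_one (by positivity) (inv_lt_one_of_one_lt₀ hQ)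
  refine (hs.mul_left (a / Q)).congr fun i => ?_
  have hQ0 : Q ≠ 0 := by linarith
  rw [pow_succ, inv_pow]
  field_simp

/-- Iterating `tsum_inv_qFac_div` from `y = -1` peels off one factor of the product at each step. -/
theorem tsum_neg_one_pow_div_qFac (hQ : 1 < Q) :
    ∑' k, (-1) ^ k / qFac Q k = ∏' i : ℕ, (1 - 1 / Q ^ (i + 1)) := by
  have hN : ∀ N : ℕ, ∑' k, (-1) ^ k / qFac Q k =
      (∏ i ∈ Finset.range N, (1 - 1 / Q ^ (i + 1))) * ∑' k, (-1 / Q ^ N) ^ k / qFac Q k := by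
    intro N
    induction N with
    | zero => simp
    | succ N ih =>
      rw [ih, tsum_inv_qFac_div hQ, Finset.prod_range_succ, div_div, ← pow_succ]
      ring
  have hm : Multipliable fun i : ℕ => 1 - 1 / Q ^ (i + 1) := by
    simpa [sub_eq_add_neg, neg_div] using multipliable_one_add_div_pow hQ (-1)
  have h1 := tendsto_tsum_mul_pow_div (a := fun k => (qFac Q k)⁻¹) (z := -1)
    (by simp [qFac_zero]) hQ ((summable_inv_qFac hQ (-1)).congr fun k => div_eq_inv_mul _ _)
  have h2 := hm.hasProd.tendsto_prod_nat.mul h1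
  rw [mul_one] at h2
  refine tendsto_nhds_unique (tendsto_const_nhds.congr fun N => ?_) h2
  rw [hN N]
  simp only [div_eq_inv_mul]

/-- Here the functional equation puts the linear factor on the other side, so the series is the
reciprocal of the product. The condition `|a| < Q` is what makes the series converge. -/
theorem tsum_pow_choose_div_qFac_mul_tprod (hQ : 1 < Q) {a : ℝ} (ha : |a| < Q) :
    (∑' k, Q ^ (k.choose 2) * (-a) ^ k / qFac Q k) * ∏' i : ℕ, (1 + a / Q ^ (i + 1)) = 1 := by
  have hQ0 : 0 < Q := by linarith
  have hN : ∀ N : ℕ, ∑' k, Q ^ (k.choose 2) * (-a / Q ^ N) ^ k / qFac Q k =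
      (∑' k, Q ^ (k.choose 2) * (-a) ^ k / qFac Q k) *
        ∏ i ∈ Finset.range N, (1 + a / Q ^ (i + 1)) := by
    intro N
    induction N with
    | zero => simp
    | succ N ih =>
      rw [pow_succ, ← div_div, tsum_pow_choose_div_qFac_div hQ, ih, Finset.prod_range_succ,
        pow_succ]
      · field_simp; ring
      · rw [abs_div, abs_neg, abs_of_pos (pow_pos hQ0 N)]
        exact (div_le_self (abs_nonneg _) (one_le_pow₀ hQ.le)).trans_lt ha
  have h1 := tendsto_tsum_mul_pow_div (a := fun k => Q ^ (k.choose 2) / qFac Q k) (z := -a)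
    (by simp [qFac_zero]) hQ ((summable_pow_choose_div_qFac hQ (by rwa [abs_neg])).congr
      fun k => by ring)
  have h2 := (multipliable_one_add_div_pow hQ a).hasProd.tendsto_prod_nat.const_mul
    (∑' k, Q ^ (k.choose 2) * (-a) ^ k / qFac Q k)
  refine tendsto_nhds_unique h2 (h1.congr fun N => ?_)
  rw [← hN N]
  exact tsum_congr fun k => by ring

end QSeries

/-! ### Euler's partition identities for infinite products. -/

section EulerProducts

variable {y : ℝ}

theorem multipliable_one_add_mul_pow (hy0 : 0 < y) (hy1 : y < 1) {a : ℕ → ℝ}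
    (ha : ∀ i, |a i| ≤ 1) {k : ℕ → ℕ} (hk : ∀ i, i ≤ k i) :
    Multipliable fun i => 1 + a i * y ^ k i := by
  have := multipliable_spLimit_aux y⁻¹ ((one_lt_inv₀ hy0).2 hy1) a ha k hk 1
  simpa [div_eq_mul_inv] using this

theorem tprod_ne_zero_of_tprod_mul_eq {a b c : ℝ} (hc : c ≠ 0) (h : a * b = c) : a ≠ 0 := by
  rintro rfl; exact hc (by rw [← h, zero_mul])

/-- Euler's identity between partitions into distinct and into odd parts. -/
theorem tprod_one_add_pow_mul_tprod_one_sub_odd_pow (hy0 : 0 < y) (hy1 : y < 1) :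
    (∏' i : ℕ, (1 + y ^ (i + 1))) * ∏' i : ℕ, (1 - y ^ (2 * i + 1)) = 1 := by
  have m1 : Multipliable fun i : ℕ => 1 + y ^ (i + 1) := by
    simpa using multipliable_one_add_mul_pow hy0 hy1 (a := fun _ => 1) (by simp)
      (k := fun i => i + 1) (by simp)
  have m2 : ∀ k : ℕ → ℕ, (∀ i, i ≤ k i) → Multipliable fun i : ℕ => 1 - y ^ (k i) := by
    intro k hk
    simpa [sub_eq_add_neg] using multipliable_one_add_mul_pow hy0 hy1 (a := fun _ => -1) (by simp)
      (k := k) hk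
  -- Nonvanishing is read off from the reciprocal identity with `Q = 1/y` and `a = -1`; it permits
  -- cancelling this product below.
  have hne : ∏' i : ℕ, (1 - y ^ (i + 1)) ≠ 0 := by
    have h := tsum_pow_choose_div_qFac_mul_tprod (Q := y⁻¹) (a := -1) ((one_lt_inv₀ hy0).2 hy1)
      (by simpa using (one_lt_inv₀ hy0).2 hy1)
    rw [mul_comm] at h
    have := tprod_ne_zero_of_tprod_mul_eq one_ne_zero h
    simpa [neg_div, ← sub_eq_add_neg] using this
  have e1 : (∏' i : ℕ, (1 + y ^ (i + 1))) * ∏' i : ℕ, (1 - y ^ (i + 1)) =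
      ∏' i : ℕ, (1 - y ^ (2 * i + 2)) := by
    rw [← m1.tprod_mul (m2 _ (by simp))]
    exact tprod_congr fun i => by ring
  have e2 : (∏' i : ℕ, (1 - y ^ (2 * i + 1))) * ∏' i : ℕ, (1 - y ^ (2 * i + 2)) =
      ∏' i : ℕ, (1 - y ^ (i + 1)) :=
    tprod_even_mul_odd (f := fun i : ℕ => 1 - y ^ (i + 1)) (m2 _ (fun i => by omega))
      (m2 _ (fun i => by omega))
  refine mul_right_cancel₀ hne ?_
  rw [mul_right_comm, e1, mul_comm, e2, one_mul]

/-- Split the second product by parity of the exponent. Its odd part combines with the first product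
into factors `1 - y^(2m)`, `m` odd, and Euler's identity for `y²` cancels these against the even
part. -/
theorem tprod_one_add_odd_pow_mul_tprod (hy0 : 0 < y) (hy1 : y < 1) :
    (∏' i : ℕ, (1 + y ^ (2 * i + 1))) * ∏' i : ℕ, (1 + (-1) ^ (i + 1) * y ^ (i + 1)) = 1 := by
  have m : ∀ (a : ℕ → ℝ) (k : ℕ → ℕ), (∀ i, |a i| ≤ 1) → (∀ i, i ≤ k i) →
      Multipliable fun i : ℕ => 1 + a i * y ^ (k i) := fun a k ha hk =>
    multipliable_one_add_mul_pow hy0 hy1 ha hk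
  have mo : Multipliable fun i : ℕ => 1 + y ^ (2 * i + 1) := by
    simpa using m (fun _ => 1) (fun i => 2 * i + 1) (by simp) (fun i => by omega)
  have mo' : Multipliable fun i : ℕ => 1 - y ^ (2 * i + 1) := by
    simpa [sub_eq_add_neg] using m (fun _ => -1) (fun i => 2 * i + 1) (by simp)
      (fun i => by omega)
  have me : Multipliable fun i : ℕ => 1 + y ^ (2 * i + 1 + 1) := by
    simpa using m (fun _ => 1) (fun i => 2 * i + 1 + 1) (by simp) (fun i => by omega)
  have hs : ∀ i : ℕ, (-1 : ℝ) ^ (2 * i + 1) = -1 := fun i => by rw [pow_succ, pow_mul]; simp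
  have hs' : ∀ i : ℕ, (-1 : ℝ) ^ (2 * i + 1 + 1) = 1 := fun i => by rw [pow_succ, hs]; simp
  have e1 := tprod_even_mul_odd (f := fun i : ℕ => 1 + (-1 : ℝ) ^ (i + 1) * y ^ (i + 1))
    (by simpa [hs, ← sub_eq_add_neg] using mo') (by simpa [hs'] using me)
  simp only [hs, hs', one_mul, neg_one_mul, ← sub_eq_add_neg] at e1
  have e2 : (∏' i : ℕ, (1 + y ^ (2 * i + 1))) * ∏' i : ℕ, (1 - y ^ (2 * i + 1)) =
      ∏' i : ℕ, (1 - (y ^ 2) ^ (2 * i + 1)) := by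
    rw [← mo.tprod_mul mo']
    exact tprod_congr fun i => by ring
  have e3 := tprod_one_add_pow_mul_tprod_one_sub_odd_pow (y := y ^ 2) (by positivity)
    (by nlinarith)
  have e4 : ∏' i : ℕ, (1 + (y ^ 2) ^ (i + 1)) = ∏' i : ℕ, (1 + y ^ (2 * i + 1 + 1)) :=
    tprod_congr fun i => by ring
  rw [← e1, ← mul_assoc, e2, ← e4, mul_comm, e3]

end EulerProducts

/-! ### The series attached to self-conjugate polynomials. -/

section LocalFactors

/-- This is the degree-one case: the series is the inverse of the product of the `1 + q^(-i)`, which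
Euler's identity turns into odd exponents. -/
theorem tsum_pow_choose_one {q : ℝ} (hq : 1 < q) :
    ∑' k, q ^ (k.choose 2) * (-1) ^ k / qFac q k = ∏' i : ℕ, (1 - 1 / q ^ (2 * i + 1)) := by
  have h1 := tsum_pow_choose_div_qFac_mul_tprod hq (a := 1) (by simpa using hq)
  have h2 := tprod_one_add_pow_mul_tprod_one_sub_odd_pow (y := q⁻¹) (by positivity)
    (inv_lt_one_of_one_lt₀ hq)
  simp only [inv_pow] at h2
  simp only [← one_div] at h2
  have h3 : ∏' i : ℕ, (1 + 1 / q ^ (i + 1)) ≠ 0 := fun h => by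
    rw [h, zero_mul] at h2; exact zero_ne_one h2
  exact mul_right_cancel₀ h3 (h1.trans (h2.symm.trans (mul_comm _ _)))

/-- The case of degree `2j`, with `p = q^j` and residue field of size `p²`: taking `a = p` in the
reciprocal identity leaves the factors `1 + p^(-(2i+1))`. -/
theorem tsum_pow_choose_sqrt {p : ℝ} (hp : 1 < p) :
    ∑' k, (p ^ 2) ^ (k.choose 2) * (-p) ^ k / qFac (p ^ 2) k =
      ∏' i : ℕ, (1 + (-1) ^ (i + 1) / p ^ (i + 1)) := by
  have h1 := tsum_pow_choose_div_qFac_mul_tprod (Q := p ^ 2) (by nlinarith) (a := p)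
    (by rw [abs_of_pos (by linarith)]; nlinarith)
  have h2 := tprod_one_add_odd_pow_mul_tprod (y := p⁻¹) (by positivity)
    (inv_lt_one_of_one_lt₀ hp)
  have h4 : ∀ i : ℕ, p / (p ^ 2) ^ (i + 1) = p⁻¹ ^ (2 * i + 1) := fun i => by
    rw [inv_pow, eq_comm, inv_eq_iff_eq_inv, inv_div, eq_div_iff (by positivity)]
    ring
  simp only [h4] at h1
  have h3 : ∏' i : ℕ, (1 + p⁻¹ ^ (2 * i + 1)) ≠ 0 := fun h => by
    rw [h, zero_mul] at h2; exact zero_ne_one h2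
  refine mul_right_cancel₀ h3 (h1.trans (h2.symm.trans (mul_comm _ _))) |>.trans ?_
  simp only [inv_pow, div_eq_mul_inv]

end LocalFactors

/-! ### Absolutely convergent sums over tuples factor. -/

section SumsOverFunctions

theorem hasSum_prod_fin {n : ℕ} (f : Fin n → ℕ → ℝ) (hf : ∀ i, Summable fun k => ‖f i k‖) :
    (Summable fun d : Fin n → ℕ => ‖∏ i, f i (d i)‖) ∧
      ∑' d : Fin n → ℕ, ∏ i, f i (d i) = ∏ i, ∑' k, f i k := by
  induction n with
  | zero => exact ⟨Summable.of_finite, by simp⟩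
  | succ n ih =>
    obtain ⟨h1, h2⟩ := ih (fun i => f i.succ) fun i => hf _
    let e : ℕ × (Fin n → ℕ) ≃ (Fin (n + 1) → ℕ) := Fin.consEquiv fun _ => ℕ
    have he : ∀ p, ∏ i, f i (e p i) = f 0 p.1 * ∏ i : Fin n, f i.succ (p.2 i) := fun p => by
      rw [Fin.prod_univ_succ]; rfl
    have hs : Summable fun p : ℕ × (Fin n → ℕ) => ‖f 0 p.1 * ∏ i : Fin n, f i.succ (p.2 i)‖ :=
      Summable.mul_norm (f := f 0) (g := fun d : Fin n → ℕ => ∏ i : Fin n, f i.succ (d i)) (hf 0) h1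
    constructor
    · exact e.summable_iff.1 (hs.congr fun p => by rw [Function.comp_apply, he])
    · refine (e.tsum_eq (fun d => ∏ i, f i (d i))).symm.trans ?_
      rw [tsum_congr he, Fin.prod_univ_succ, ← h2, tsum_mul_tsum_of_summable_norm (hf 0) h1]

theorem summable_norm_prod_pi {ι : Type*} [Fintype ι] (f : ι → ℕ → ℝ)
    (hf : ∀ i, Summable fun k => ‖f i k‖) : Summable fun d : ι → ℕ => ‖∏ i, f i (d i)‖ := by
  let e := Fintype.equivFin ι
  rw [← (Equiv.arrowCongr e (Equiv.refl ℕ)).symm.summable_iff]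
  refine (hasSum_prod_fin (fun i => f (e.symm i)) fun i => hf _).1.congr fun d => ?_
  rw [Function.comp_apply, ← e.symm.prod_comp]
  simp

theorem tsum_prod_pi {ι : Type*} [Fintype ι] (f : ι → ℕ → ℝ)
    (hf : ∀ i, Summable fun k => ‖f i k‖) :
    ∑' d : ι → ℕ, ∏ i, f i (d i) = ∏ i, ∑' k, f i k := by
  let e := Fintype.equivFin ι
  rw [← (Equiv.arrowCongr e (Equiv.refl ℕ)).symm.tsum_eq, ← e.symm.prod_comp,
    ← (hasSum_prod_fin (fun i => f (e.symm i)) fun i => hf _).2]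
  refine tsum_congr fun d => ?_
  rw [← e.symm.prod_comp]
  simp

end SumsOverFunctions

/-! ### Inversion over subspaces of a finite vector space. -/

section Moebius

/-- A closed form for the partial sums, with `y` free so that induction on `N` goes through. -/
theorem sum_range_neg_one_pow_prod_div_qFac {Q : ℝ} (hQ : 1 < Q) (y : ℝ) (N : ℕ) :
    ∑ d ∈ Finset.range (N + 1), (-1) ^ d / qFac Q d * ∏ k ∈ Finset.range d, (y - Q ^ k) =
      (-1) ^ N / qFac Q N * ∏ k ∈ Finset.range N, (y - Q ^ (k + 1)) := by
  induction N with
  | zero => simp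
  | succ N ih =>
    have h1 := (qFac_pos hQ N).ne'
    have h2 := (pow_sub_one_pos hQ N).ne'
    rw [Finset.sum_range_succ, ih, Finset.prod_range_succ' (fun k => y - Q ^ k) N,
      Finset.prod_range_succ (fun k => y - Q ^ (k + 1)) N, qFac_succ]
    field_simp
    ring

/-- At `y = Q^m` with `1 ≤ m ≤ N` the closed form has a zero factor; at `m = 0` its product is
`(-1)^N qFac Q N`. -/
theorem sum_range_neg_one_pow_prod_div_qFac_eq_ite {Q : ℝ} (hQ : 1 < Q) {m N : ℕ} (h : m ≤ N) :
    ∑ d ∈ Finset.range (N + 1), (-1) ^ d / qFac Q d * ∏ k ∈ Finset.range d, (Q ^ m - Q ^ k) =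
      if m = 0 then 1 else 0 := by
  rw [sum_range_neg_one_pow_prod_div_qFac hQ]
  split_ifs with hm
  · have : ∏ k ∈ Finset.range N, (Q ^ m - Q ^ (k + 1)) = (-1) ^ N * qFac Q N := by
      rw [qFac, ← Finset.card_range N, ← Finset.prod_const, Finset.card_range,
        ← Finset.prod_mul_distrib]
      exact Finset.prod_congr rfl fun k _ => by rw [hm]; ring
    rw [this, div_mul_eq_mul_div, ← mul_assoc, ← mul_pow]
    simp [(qFac_pos hQ N).ne']
  · obtain ⟨m, rfl⟩ := Nat.exists_eq_succ_of_ne_zero hm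
    rw [Finset.prod_eq_zero (Finset.mem_range.2 h) (sub_self _), mul_zero]

end Moebius

/-! ### Invariant forms on direct sums, and orthogonality of coprime components. -/

section InvariantForms

variable {F : Type u} [Field F]

/-- The bilinear pairings preserved by a pair of endomorphisms. -/
def InvForms {E E' : Type*} [AddCommGroup E] [Module F E] [AddCommGroup E'] [Module F E']
    (X : E →ₗ[F] E) (Y : E' →ₗ[F] E') : Set (E →ₗ[F] E' →ₗ[F] F) :=
  {b | ∀ x y, b (X x) (Y y) = b x y}

/-- The endomorphism of a product acting componentwise. -/
def piEnd {ι : Type*} {E : ι → Type*} [∀ i, AddCommGroup (E i)]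
    [∀ i, Module F (E i)] (X : ∀ i, E i →ₗ[F] E i) : (∀ i, E i) →ₗ[F] ∀ i, E i :=
  LinearMap.pi fun i => X i ∘ₗ LinearMap.proj i

theorem piEnd_single {ι : Type*} [DecidableEq ι] {E : ι → Type*} [∀ i, AddCommGroup (E i)]
    [∀ i, Module F (E i)] (X : ∀ i, E i →ₗ[F] E i) (i : ι) (x : E i) : piEnd X (Pi.single i x) = Pi.single i (X i x) := by
  ext j
  rcases eq_or_ne j i with rfl | h
  · simp [piEnd]
  · simp [piEnd, h]

section Pi

variable {ι : Type*} [Fintype ι] [LinearOrder ι] {E : ι → Type*} [∀ i, AddCommGroup (E i)]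
  [∀ i, Module F (E i)] (X : ∀ i, E i →ₗ[F] E i)

/-- The blocks of a form on a product. -/
def blocks (β : InvAltForms (piEnd X)) : (∀ i, InvAltForms (X i)) ×
    ∀ p : {p : ι × ι // p.1 < p.2}, InvForms (X p.1.1) (X p.1.2) :=
  (fun i => ⟨β.1.compl₁₂ (LinearMap.single F E i) (LinearMap.single F E i),
      fun x => β.2.1 _, fun x y => by
        simp only [LinearMap.compl₁₂_apply, LinearMap.single_apply]
        rw [← piEnd_single, ← piEnd_single, β.2.2]⟩,
    fun p => ⟨β.1.compl₁₂ (LinearMap.single F E p.1.1) (LinearMap.single F E p.1.2),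
      fun x y => by
        simp only [LinearMap.compl₁₂_apply, LinearMap.single_apply]
        rw [← piEnd_single, ← piEnd_single, β.2.2]⟩)

/-- Blocks below the diagonal are minus the transposes of those above it. -/
theorem blocks_injective : Function.Injective (blocks X) := by
  rintro ⟨β, hβ, hβX⟩ ⟨γ, hγ, hγX⟩ h
  refine Subtype.ext (?_ : β = γ)
  have h1 : ∀ i x y, β (Pi.single i x) (Pi.single i y) = γ (Pi.single i x) (Pi.single i y) :=
    fun i x y => DFunLike.congr_fun (DFunLike.congr_fun
      (congrArg Subtype.val (congrFun (congrArg Prod.fst h) i)) x) y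
  have h2 : ∀ i j x y, i < j →
      β (Pi.single i x) (Pi.single j y) = γ (Pi.single i x) (Pi.single j y) :=
    fun i j x y hij => DFunLike.congr_fun (DFunLike.congr_fun
      (congrArg Subtype.val (congrFun (congrArg Prod.snd h) ⟨(i, j), hij⟩)) x) y
  refine LinearMap.pi_ext' fun i => LinearMap.ext fun x => LinearMap.pi_ext' fun j =>
    LinearMap.ext fun y => ?_
  simp only [LinearMap.comp_apply, LinearMap.single_apply]
  rcases lt_trichotomy i j with hij | rfl | hij
  · exact h2 i j x y hij
  · exact h1 i x y
  · rw [← hβ.neg_eq, ← hγ.neg_eq, h2 j i y x hij]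

/-- The form on a product with given blocks. -/
def ofBlocks (a : ∀ i, LinearMap.BilinForm F (E i))
    (b : ∀ p : {p : ι × ι // p.1 < p.2}, E p.1.1 →ₗ[F] E p.1.2 →ₗ[F] F) :
    LinearMap.BilinForm F (∀ i, E i) :=
  ∑ i, (a i).compl₁₂ (LinearMap.proj i) (LinearMap.proj i) +
    ∑ p, ((b p).compl₁₂ (LinearMap.proj p.1.1) (LinearMap.proj p.1.2) -
      (b p).flip.compl₁₂ (LinearMap.proj p.1.2) (LinearMap.proj p.1.1))

theorem ofBlocks_apply (a : ∀ i, LinearMap.BilinForm F (E i))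
    (b : ∀ p : {p : ι × ι // p.1 < p.2}, E p.1.1 →ₗ[F] E p.1.2 →ₗ[F] F) (x y : ∀ i, E i) :
    ofBlocks a b x y = ∑ i, a i (x i) (y i) +
      ∑ p : {p : ι × ι // p.1 < p.2}, (b p (x p.1.1) (y p.1.2) - b p (y p.1.1) (x p.1.2)) := by
  simp [ofBlocks, LinearMap.sum_apply]

theorem blocks_surjective : Function.Surjective (blocks X) := by
  rintro ⟨a, b⟩
  refine ⟨⟨ofBlocks (fun i => (a i).1) (fun p => (b p).1), fun x => ?_, fun x y => ?_⟩, ?_⟩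
  · rw [ofBlocks_apply]
    simp [((a _).2.1).self_eq_zero]
  · rw [ofBlocks_apply, ofBlocks_apply]
    congr 1
    · exact Finset.sum_congr rfl fun i _ => (a i).2.2 _ _
    · exact Finset.sum_congr rfl fun p _ => congrArg₂ (· - ·) ((b p).2 _ _) ((b p).2 _ _)
  · refine Prod.ext (funext fun i => Subtype.ext (LinearMap.ext₂ fun x y => ?_))
      (funext fun p => Subtype.ext (LinearMap.ext₂ fun x y => ?_))
    · simp only [blocks, LinearMap.compl₁₂_apply, LinearMap.single_apply, ofBlocks_apply]
      rw [Finset.sum_eq_single i (fun j _ hj => by simp [hj]) (by simp),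
        Finset.sum_eq_zero, add_zero, Pi.single_eq_same, Pi.single_eq_same]
      rintro ⟨⟨j, k⟩, hjk⟩ -
      rcases eq_or_ne k i with rfl | hk
      · simp [hjk.ne]
      · simp [hk]
    · obtain ⟨⟨i, j⟩, hij⟩ := p
      simp only [blocks, LinearMap.compl₁₂_apply, LinearMap.single_apply, ofBlocks_apply]
      rw [Finset.sum_eq_zero, Finset.sum_eq_single ⟨(i, j), hij⟩, zero_add, Pi.single_eq_same,
        Pi.single_eq_same, Pi.single_eq_of_ne hij.ne]
      · simp
      · rintro ⟨⟨k, l⟩, hkl⟩ - hne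
        dsimp only at hij hkl ⊢
        have h2 : (Pi.single i x : ∀ i, E i) k = 0 ∨ (Pi.single j y : ∀ i, E i) l = 0 := by
          by_contra! hcon
          have hk : k = i := by by_contra hk; exact hcon.1 (Pi.single_eq_of_ne hk _)
          have hl : l = j := by by_contra hl; exact hcon.2 (Pi.single_eq_of_ne hl _)
          exact hne (Subtype.ext (Prod.ext hk hl))
        have h3 : (Pi.single j y : ∀ i, E i) k = 0 ∨ (Pi.single i x : ∀ i, E i) l = 0 := by
          by_contra! hcon
          have hk : k = j := by by_contra hk; exact hcon.1 (Pi.single_eq_of_ne hk _)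
          have hl : l = i := by by_contra hl; exact hcon.2 (Pi.single_eq_of_ne hl _)
          exact lt_asymm hij (by rwa [hk, hl] at hkl)
        have h4 : (b ⟨(k, l), hkl⟩).1 ((Pi.single i x : ∀ i, E i) k)
            ((Pi.single j y : ∀ i, E i) l) = 0 := by
          rcases h2 with h | h <;> simp [h]
        have h5 : (b ⟨(k, l), hkl⟩).1 ((Pi.single j y : ∀ i, E i) k)
            ((Pi.single i x : ∀ i, E i) l) = 0 := by
          rcases h3 with h | h <;> simp [h]
        rw [h4, h5, sub_zero]
      · simp
      · intro k _
        rcases eq_or_ne k i with rfl | hk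
        · simp [hij.ne]
        · simp [hk]

theorem card_invAltForms_piEnd : Nat.card (InvAltForms (piEnd X)) =
    (∏ i, Nat.card (InvAltForms (X i))) *
      ∏ p : {p : ι × ι // p.1 < p.2}, Nat.card (InvForms (X p.1.1) (X p.1.2)) := by
  rw [Nat.card_eq_of_bijective _ ⟨blocks_injective X, blocks_surjective X⟩, Nat.card_prod,
    Nat.card_pi, Nat.card_pi]

end Pi

theorem card_subtype_fst_lt_snd (d : ℕ) :
    Fintype.card {p : Fin d × Fin d // p.1 < p.2} = d.choose 2 := by
  rw [Fintype.card_subtype, Fintype.card_product_filter_lt, Fintype.card_fin]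

section Reverse

variable {E E' : Type*} [AddCommGroup E] [Module F E] [AddCommGroup E'] [Module F E']
  {X : E →ₗ[F] E} {Y : E' →ₗ[F] E'} {b : E →ₗ[F] E' →ₗ[F] F}

theorem InvForms.pow_apply (hb : b ∈ InvForms X Y) (k : ℕ) (x : E) (y : E') :
    b ((X ^ k) x) ((Y ^ k) y) = b x y := by
  induction k generalizing x y with
  | zero => rfl
  | succ k ih => rw [pow_succ, pow_succ, Module.End.mul_apply, Module.End.mul_apply, ih, hb]

/-- Invariance moves `X^k` across the form as `Y^(-k)`; the extra `Y^(deg p)` clears the negative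
powers and reverses the coefficients, so `Y` need not be invertible. -/
theorem InvForms.aeval_apply (hb : b ∈ InvForms X Y) (p : F[X]) (x : E) (y : E') :
    b (aeval X p x) ((Y ^ p.natDegree) y) = b x (aeval Y p.reverse y) := by
  rw [aeval_eq_sum_range, aeval_eq_sum_range' (n := p.natDegree + 1)
    (Nat.lt_succ_of_le (reverse_natDegree_le p)), ← Finset.sum_range_reflect]
  simp only [LinearMap.sum_apply, map_sum, LinearMap.smul_apply, map_smul]
  refine Finset.sum_congr rfl fun k hk => ?_
  have hk' : k ≤ p.natDegree := by simpa [Nat.lt_succ_iff] using hk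
  have e : p.natDegree + 1 - 1 - k = p.natDegree - k := by omega
  rw [e, coeff_reverse, revAt_le hk']
  have e2 : p.natDegree = (p.natDegree - k) + k := by omega
  conv_lhs => rw [e2, pow_add, Module.End.mul_apply]
  rw [Nat.add_sub_cancel, InvForms.pow_apply hb]

/-- Coprimality makes `p.reverse` act invertibly through `Y`, while every value `b(x, p.reverse(Y)
y)` equals a pairing against `p(X) x = 0`. -/
theorem InvForms.eq_zero_of_isCoprime (hb : b ∈ InvForms X Y) {p r : F[X]} (hp : aeval X p = 0)
    (hr : aeval Y r = 0) (h : IsCoprime p.reverse r) : b = 0 := by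
  obtain ⟨s, t, hst⟩ := h
  ext x y
  have h1 := congrArg (aeval Y) hst
  rw [map_add, map_mul, map_mul, hr, mul_zero, add_zero, map_one, ← map_mul, mul_comm,
    map_mul] at h1
  have h2 := DFunLike.congr_fun h1 y
  rw [Module.End.mul_apply, Module.End.one_apply] at h2
  rw [← h2, ← InvForms.aeval_apply hb, hp]
  simp

end Reverse

end InvariantForms

/-! ### Invariant alternating forms on a simple field extension. -/

section FieldForms

variable {F K : Type u} [Field F] [Field K] [Algebra F K]

/-- The adjoint of multiplication by `θ` is multiplication by `θ⁻¹ = σ θ`, and the elements whose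
adjoint is given by `σ` form a subalgebra. -/
theorem InvForms.mul_apply_of_adjoin_eq_top {θ : K} (hθ : θ ≠ 0)
    (htop : Algebra.adjoin F {θ} = ⊤) {σ : K →ₐ[F] K} (hσ : σ θ = θ⁻¹)
    {b : LinearMap.BilinForm F K} (hb : b ∈ InvForms (LinearMap.mulLeft F θ) (LinearMap.mulLeft F θ))
    (a : K) : ∀ e c, b (a * e) c = b e (σ a * c) := by
  have ha : a ∈ Algebra.adjoin F {θ} := htop ▸ Algebra.mem_top
  induction ha using Algebra.adjoin_induction with
  | mem x hx =>
    obtain rfl := Set.mem_singleton_iff.1 hx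
    intro e c
    rw [hσ]
    have := hb e (x⁻¹ * c)
    rwa [LinearMap.mulLeft_apply, LinearMap.mulLeft_apply, mul_inv_cancel_left₀ hθ] at this
  | algebraMap r =>
    intro e c
    rw [AlgHom.commutes, ← Algebra.smul_def, ← Algebra.smul_def, map_smul, map_smul,
      LinearMap.smul_apply]
  | add x y _ _ hx hy => intro e c; rw [add_mul, map_add, map_add, add_mul, map_add, ← hx, ← hy,
      LinearMap.add_apply]
  | mul x y _ _ hx hy =>
    intro e c
    rw [mul_assoc, hx, hy, map_mul σ, ← mul_assoc, mul_comm (σ x)]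

theorem involutive_of_adjoin_eq_top {θ : K}
    (htop : Algebra.adjoin F {θ} = ⊤) {σ : K →ₐ[F] K} (hσ : σ θ = θ⁻¹) (a : K) :
    σ (σ a) = a := by
  have : σ.comp σ = AlgHom.id F K := by
    refine AlgHom.ext_of_adjoin_eq_top htop fun x hx => ?_
    obtain rfl := Set.mem_singleton_iff.1 hx
    simp [hσ]
  exact DFunLike.congr_fun this a

/-- The invariant forms on a simple extension correspond to linear functionals. -/
def invFormsEquivDual {θ : K} (hθ : θ ≠ 0)
    (htop : Algebra.adjoin F {θ} = ⊤) {σ : K →ₐ[F] K} (hσ : σ θ = θ⁻¹) :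
    InvForms (LinearMap.mulLeft F θ) (LinearMap.mulLeft F θ) ≃ Module.Dual F K where
  toFun b := b.1 1
  invFun l := ⟨((LinearMap.mul F K).compl₁₂ σ.toLinearMap LinearMap.id).compr₂ l, fun x y => by
    have : σ (θ * x) * (θ * y) = σ x * y := by
      rw [map_mul, hσ]; field_simp
    simpa using congrArg l this⟩
  left_inv b := by
    ext x y
    simp [← InvForms.mul_apply_of_adjoin_eq_top hθ htop hσ b.2]
  right_inv l := by ext x; simp

/-- With `δ = σ c - c` and `K₀` the fixed space, both the image of `σ - 1` and the kernel of `σ + 1`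
are `δ K₀`. Rank-nullity then gives the dimension and the surjectivity of the trace onto `K₀`; the
argument covers characteristic two. -/
theorem finrank_eq_two_mul_of_involution [FiniteDimensional F K] {σ : K →ₐ[F] K}
    (hσ : ∀ a, σ (σ a) = a) {c : K} (hc : σ c ≠ c) :
    Module.finrank F K = 2 * Module.finrank F (LinearMap.ker (σ.toLinearMap - LinearMap.id)) ∧
      LinearMap.range (σ.toLinearMap + LinearMap.id) =
        LinearMap.ker (σ.toLinearMap - LinearMap.id) := by
  set K₀ := LinearMap.ker (σ.toLinearMap - LinearMap.id) with hK₀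
  have hmem : ∀ a, a ∈ K₀ ↔ σ a = a := fun a => by simp [hK₀, sub_eq_zero]
  set δ := σ c - c with hδ
  have hδ0 : δ ≠ 0 := sub_ne_zero.2 hc
  have hσδ : σ δ = -δ := by rw [hδ, map_sub, hσ]; ring
  have hmap : ∀ y, y ∈ K₀.map (LinearMap.mulLeft F δ) ↔ σ y = -y := by
    intro y
    constructor
    · rintro ⟨k, hk, rfl⟩
      rw [LinearMap.mulLeft_apply, map_mul, hσδ, (hmem k).1 hk, neg_mul]
    · intro hy
      refine ⟨δ⁻¹ * y, (hmem _).2 ?_, ?_⟩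
      · rw [map_mul, map_inv₀, hσδ, hy, inv_neg, neg_mul_neg]
      · rw [LinearMap.mulLeft_apply, mul_inv_cancel_left₀ hδ0]
  have hinj : Function.Injective (LinearMap.mulLeft F δ) := fun x y h => mul_left_cancel₀ hδ0 h
  have hfr : Module.finrank F (K₀.map (LinearMap.mulLeft F δ)) = Module.finrank F K₀ :=
    (K₀.equivMapOfInjective _ hinj).finrank_eq.symm
  have h1 : LinearMap.range (σ.toLinearMap - LinearMap.id) = K₀.map (LinearMap.mulLeft F δ) := by
    refine le_antisymm ?_ ?_
    · rintro _ ⟨a, rfl⟩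
      rw [hmap]
      simp [hσ]
    · rintro _ ⟨k, hk, rfl⟩
      refine ⟨k * c, ?_⟩
      simp [(hmem k).1 hk, hδ]
      ring
  have h2 : LinearMap.ker (σ.toLinearMap + LinearMap.id) = K₀.map (LinearMap.mulLeft F δ) := by
    ext y
    rw [hmap]
    simp [eq_neg_iff_add_eq_zero]
  have h3 := LinearMap.finrank_range_add_finrank_ker (σ.toLinearMap - LinearMap.id)
  have h4 := LinearMap.finrank_range_add_finrank_ker (σ.toLinearMap + LinearMap.id)
  rw [h1, hfr, ← hK₀] at h3
  rw [h2, hfr] at h4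
  refine ⟨by omega, Submodule.eq_of_le_of_finrank_le ?_ (by omega)⟩
  rintro _ ⟨a, rfl⟩
  rw [hmem]
  simp [hσ, add_comm]

theorem card_invAltForms_of_involution [Finite F] [FiniteDimensional F K] {θ : K} (hθ : θ ≠ 0)
    (htop : Algebra.adjoin F {θ} = ⊤) {σ : K →ₐ[F] K} (hσ : σ θ = θ⁻¹) (hne : θ⁻¹ ≠ θ) :
    ∃ j, Module.finrank F K = 2 * j ∧
      Nat.card (InvAltForms (LinearMap.mulLeft F θ)) = Nat.card F ^ j := by
  have hinv := involutive_of_adjoin_eq_top htop hσ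
  obtain ⟨h1, h2⟩ := finrank_eq_two_mul_of_involution hinv (c := θ) (by rwa [hσ])
  set K₀ := LinearMap.ker (σ.toLinearMap - LinearMap.id) with hK₀
  have hmem : ∀ a, a ∈ K₀ ↔ σ a = a := fun a => by simp [hK₀, sub_eq_zero]
  refine ⟨_, h1, ?_⟩
  have hfr := Subspace.finrank_add_finrank_dualAnnihilator_eq K₀
  have hcard : Nat.card K₀.dualAnnihilator = Nat.card F ^ Module.finrank F K₀ := by
    rw [Module.natCard_eq_pow_finrank (K := F)]
    congr 1
    omega
  rw [← hcard]
  let e := invFormsEquivDual hθ htop hσ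
  refine Nat.card_congr ?_
  -- Write `b(a, c) = l(σ(a) c)`. If `b` is alternating, `l(σ a + a) = b(a, 1) + b(1, a) = 0`, and
  -- traces fill `K₀`. Conversely `b(a, a) = l(σ(a) a)` evaluates `l` on a norm, which lies in `K₀`.
  have key : ∀ b : InvForms (LinearMap.mulLeft F θ) (LinearMap.mulLeft F θ),
      LinearMap.BilinForm.IsAlt b.1 ↔ e b ∈ K₀.dualAnnihilator := by
    intro b
    have hb : ∀ a c, b.1 a c = b.1 1 (σ a * c) := fun a c => by
      rw [← InvForms.mul_apply_of_adjoin_eq_top hθ htop hσ b.2, mul_one]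
    rw [Submodule.mem_dualAnnihilator]
    change _ ↔ ∀ w ∈ K₀, b.1 1 w = 0
    constructor
    · intro hA w hw
      rw [← h2] at hw
      obtain ⟨a, rfl⟩ := hw
      have h3 := hA.neg_eq 1 a
      have h4 := hb a 1
      rw [mul_one] at h4
      rw [LinearMap.add_apply, AlgHom.toLinearMap_apply, LinearMap.id_apply, map_add, ← h4, ← h3]
      ring
    · intro h a
      rw [hb]
      refine h _ ((hmem _).2 ?_)
      rw [map_mul, hinv, mul_comm]
  exact
    { toFun := fun b => ⟨e ⟨b.1, b.2.2⟩, (key ⟨b.1, b.2.2⟩).1 b.2.1⟩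
      invFun := fun l => ⟨(e.symm l.1).1, (key _).2 (by simp), (e.symm l.1).2⟩
      left_inv := fun b => by simp
      right_inv := fun l => Subtype.ext (e.apply_symm_apply l.1) }

theorem card_invAltForms_of_finrank_eq_one (h : Module.finrank F K = 1) (X : K →ₗ[F] K) :
    Nat.card (InvAltForms X) = 1 := by
  rw [Nat.card_eq_one_iff_unique]
  refine ⟨⟨fun b c => ?_⟩, ⟨⟨0, fun x => rfl, fun x y => rfl⟩⟩⟩
  have key : ∀ b : InvAltForms X, b.1 = 0 := by
    intro b
    ext x y
    obtain ⟨r, rfl⟩ := (finrank_eq_one_iff_of_nonzero' (1 : K) one_ne_zero).1 h x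
    obtain ⟨s, rfl⟩ := (finrank_eq_one_iff_of_nonzero' (1 : K) one_ne_zero).1 h y
    simp [b.2.1.self_eq_zero]
  exact Subtype.ext ((key b).trans (key c).symm)

end FieldForms

/-! ### Counting embeddings of a semisimple module with one isotypic type. -/

section KernelModule

variable {F V : Type u} [Field F] [AddCommGroup V] [Module F V]

theorem aeval_mem_ker_aeval (T : V →ₗ[F] V) (φ : F[X]) {x : V}
    (hx : x ∈ LinearMap.ker (aeval T φ)) : T x ∈ LinearMap.ker (aeval T φ) := by
  rw [LinearMap.mem_ker] at hx ⊢
  have : aeval T φ * T = T * aeval T φ := by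
    have h := congrArg (aeval T) (mul_comm φ X)
    simpa using h
  rw [← Module.End.mul_apply, this, Module.End.mul_apply, hx, map_zero]

theorem coe_aeval_restrict {T : V →ₗ[F] V} {W : Submodule F V} (h : ∀ x ∈ W, T x ∈ W) (p : F[X])
    (w : W) : ((aeval (T.restrict h) p w : W) : V) = aeval T p w := by
  induction p using Polynomial.induction_on' generalizing w with
  | add p r hp hr => simp [hp, hr]
  | monomial n a =>
    have : ∀ w : W, (((T.restrict h ^ n) w : W) : V) = (T ^ n) w := by
      induction n with
      | zero => intro w; rfl
      | succ n ih => intro w; rw [pow_succ, pow_succ, Module.End.mul_apply, ih,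
          Module.End.mul_apply, LinearMap.coe_restrict_apply]
    simp [aeval_monomial, this, Module.algebraMap_end_apply]

/-- The action of `F[X] / φ` on `ker φ(T)`. -/
def kerAction (T : V →ₗ[F] V) (φ : F[X]) :
    AdjoinRoot φ →+* Module.End F (LinearMap.ker (aeval T φ)) :=
  Ideal.Quotient.lift (Ideal.span {φ})
    (aeval (T.restrict fun _ => aeval_mem_ker_aeval T φ) : F[X] →ₐ[F] _).toRingHom <| by
      intro a ha
      obtain ⟨r, rfl⟩ := Ideal.mem_span_singleton'.1 ha
      ext w
      change ((aeval (T.restrict _) (r * φ) w : LinearMap.ker (aeval T φ)) : V) = 0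
      rw [coe_aeval_restrict, map_mul, Module.End.mul_apply, LinearMap.mem_ker.1 w.2, map_zero]

theorem coe_kerAction_mk (T : V →ₗ[F] V) (φ p : F[X]) (w : LinearMap.ker (aeval T φ)) :
    (kerAction T φ (AdjoinRoot.mk φ p) w : V) = aeval T p w :=
  coe_aeval_restrict _ _ _

/-- `ker φ(T)` as a vector space over `F[X] / φ`. -/
abbrev kerModule (T : V →ₗ[F] V) (φ : F[X]) :
    Module (AdjoinRoot φ) (LinearMap.ker (aeval T φ)) :=
  Module.compHom _ (kerAction T φ)

/-- Multiplication by the root of `φ` on `(F[X] / φ) ^ d`. -/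
def rootEnd (φ : F[X]) (d : ℕ) : (Fin d → AdjoinRoot φ) →ₗ[F] (Fin d → AdjoinRoot φ) :=
  piEnd fun _ => LinearMap.mulLeft F (AdjoinRoot.root φ)

theorem rootEnd_apply (φ : F[X]) (d : ℕ) (x : Fin d → AdjoinRoot φ) (k : Fin d) :
    rootEnd φ d x k = AdjoinRoot.root φ * x k := rfl

theorem aeval_rootEnd_apply (φ : F[X]) (d : ℕ) (p : F[X]) (x : Fin d → AdjoinRoot φ) :
    aeval (rootEnd φ d) p x = AdjoinRoot.mk φ p • x := by
  induction p using Polynomial.induction_on' generalizing x with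
  | add p r hp hr => rw [map_add, LinearMap.add_apply, hp, hr, map_add, add_smul]
  | monomial n a =>
    have : ∀ x, (rootEnd φ d ^ n) x = AdjoinRoot.root φ ^ n • x := by
      induction n with
      | zero => intro w; simp
      | succ n ih =>
        intro w
        rw [pow_succ, Module.End.mul_apply, ih]
        ext k
        simp [rootEnd_apply, pow_succ, mul_assoc]
    rw [aeval_monomial, Module.End.mul_apply, this, Module.algebraMap_end_apply,
      ← C_mul_X_pow_eq_monomial, map_mul, map_pow, AdjoinRoot.mk_X, AdjoinRoot.mk_C, mul_smul]
    ext k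
    simp [Algebra.smul_def]

theorem aeval_apply_of_comp_eq {E : Type*} [AddCommGroup E] [Module F E] {T : V →ₗ[F] V}
    {X' : E →ₗ[F] E} {f : E →ₗ[F] V} (h : T ∘ₗ f = f ∘ₗ X') (p : F[X]) (x : E) :
    aeval T p (f x) = f (aeval X' p x) := by
  induction p using Polynomial.induction_on' generalizing x with
  | add p r hp hr => simp [hp, hr]
  | monomial n a =>
    have : ∀ x, (T ^ n) (f x) = f ((X' ^ n) x) := by
      induction n with
      | zero => intro x; rfl
      | succ n ih =>
        intro x
        rw [pow_succ, pow_succ, Module.End.mul_apply, Module.End.mul_apply, ← ih]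
        exact congrArg _ (DFunLike.congr_fun h x)
    simp [aeval_monomial, this, Module.algebraMap_end_apply]

variable (T : V →ₗ[F] V) (φ : F[X]) [Fact (Irreducible φ)]

/-- The injective linear maps from `E` to `V` that intertwine two endomorphisms. -/
def Intertwiners {E : Type*} [AddCommGroup E] [Module F E] (X' : E →ₗ[F] E) (T : V →ₗ[F] V) :
    Set (E →ₗ[F] V) :=
  {f | Function.Injective f ∧ T ∘ₗ f = f ∘ₗ X'}

/-- A module map is determined by the images of the standard basis vectors, which may be any
elements of the kernel of `φ(T)`; it is injective exactly when they are independent over `F[X]/φ`.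
-/
theorem card_intertwiners_rootEnd (d : ℕ) :
    Nat.card (Intertwiners (rootEnd φ d) T) =
      letI := kerModule T φ
      Nat.card {s : Fin d → LinearMap.ker (aeval T φ) // LinearIndependent (AdjoinRoot φ) s} := by
  let := kerModule T φ
  have hsmul : ∀ p (w : LinearMap.ker (aeval T φ)), ((AdjoinRoot.mk φ p • w :
      LinearMap.ker (aeval T φ)) : V) = aeval T p w := coe_kerAction_mk T φ
  have : IsScalarTower F (AdjoinRoot φ) (LinearMap.ker (aeval T φ)) := ⟨fun r k w => by
    induction k using AdjoinRoot.induction_on with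
    | ih p =>
      ext
      rw [AdjoinRoot.smul_mk, hsmul, map_smul, LinearMap.smul_apply, Submodule.coe_smul, hsmul]⟩
  let W := LinearMap.ker (aeval T φ)
  let L : (Fin d → W) → ((Fin d → AdjoinRoot φ) →ₗ[F] V) := fun s =>
    W.subtype ∘ₗ (Fintype.linearCombination (AdjoinRoot φ) s).restrictScalars F
  have hL : ∀ s x, L s x = ((∑ k, x k • s k : W) : V) := fun s x => rfl
  have hL1 : ∀ s k, L s (Pi.single k 1) = s k := fun s k => by
    rw [hL, Finset.sum_eq_single k (fun j _ hj => by simp [hj]) (by simp), Pi.single_eq_same,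
      one_smul]
  have hmem : ∀ s : {s : Fin d → W // LinearIndependent (AdjoinRoot φ) s},
      L s.1 ∈ Intertwiners (rootEnd φ d) T := by
    intro s
    refine ⟨W.injective_subtype.comp (linearIndependent_iff_injective_fintypeLinearCombination.1 s.2), ?_⟩
    refine LinearMap.ext fun x => ?_
    change T (L s.1 x) = L s.1 (rootEnd φ d x)
    rw [hL, hL]
    simp only [rootEnd_apply, mul_smul]
    rw [← Finset.smul_sum, ← AdjoinRoot.mk_X, hsmul, aeval_X]
  refine (Nat.card_eq_of_bijective (fun s => ⟨L s.1, hmem s⟩) ⟨?_, ?_⟩).symm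
  · intro s s' h
    have h' := congrArg Subtype.val h
    refine Subtype.ext (funext fun k => Subtype.ext ?_)
    rw [← hL1, ← hL1]
    exact DFunLike.congr_fun h' _
  · rintro ⟨f, hf, hfT⟩
    have hker : ∀ x, f x ∈ W := fun x => by
      rw [LinearMap.mem_ker, aeval_apply_of_comp_eq hfT, aeval_rootEnd_apply, AdjoinRoot.mk_self,
        zero_smul, map_zero]
    have hfL : L (fun k => ⟨f (Pi.single k 1), hker _⟩) = f := by
      refine LinearMap.pi_ext fun k a => ?_
      rw [hL, Finset.sum_eq_single k (fun j _ hj => by simp [hj]) (by simp), Pi.single_eq_same]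
      induction a using AdjoinRoot.induction_on with
      | ih p =>
        rw [hsmul, aeval_apply_of_comp_eq hfT, aeval_rootEnd_apply, ← Pi.single_smul, smul_eq_mul,
          mul_one]
    refine ⟨⟨fun k => ⟨f (Pi.single k 1), hker _⟩, ?_⟩, Subtype.ext hfL⟩
    rw [linearIndependent_iff_injective_fintypeLinearCombination]
    rw [← hfL] at hf
    exact fun x y h => hf (congrArg Subtype.val h)

theorem card_intertwiners_rootEnd_eq_prod [Finite F] [FiniteDimensional F V] :
    ∃ m : ℕ, m ≤ Module.finrank F V ∧ (m = 0 ↔ LinearMap.ker (aeval T φ) = ⊥) ∧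
      ∀ d, (Nat.card (Intertwiners (rootEnd φ d) T) : ℝ) =
        ∏ k ∈ Finset.range d, ((Nat.card (AdjoinRoot φ) : ℝ) ^ m - (Nat.card (AdjoinRoot φ)) ^ k) := by
  let := kerModule T φ
  have hφ : φ ≠ 0 := (Fact.out : Irreducible φ).ne_zero
  have : FiniteDimensional F (AdjoinRoot φ) := (AdjoinRoot.powerBasis hφ).finite
  have : Finite (AdjoinRoot φ) := Module.finite_of_finite F
  have := Fintype.ofFinite (AdjoinRoot φ)
  have : Finite V := Module.finite_of_finite F
  have hcard := Module.natCard_eq_pow_finrank (K := AdjoinRoot φ) (V := LinearMap.ker (aeval T φ))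
  have hq : 1 < Nat.card F := Finite.one_lt_card
  have hQ : 1 < Nat.card (AdjoinRoot φ) := Finite.one_lt_card
  refine ⟨Module.finrank (AdjoinRoot φ) (LinearMap.ker (aeval T φ)), ?_, ?_, fun d => ?_⟩
  · have h1 := Module.natCard_eq_pow_finrank (K := F) (V := LinearMap.ker (aeval T φ))
    have h2 := Module.natCard_eq_pow_finrank (K := F) (V := AdjoinRoot φ)
    have h3 : 0 < Module.finrank F (AdjoinRoot φ) := Module.finrank_pos
    rw [h1, h2, ← pow_mul] at hcard
    have h4 := Nat.pow_right_injective hq hcard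
    have h5 := (LinearMap.ker (aeval T φ)).finrank_le
    nlinarith
  · rw [← Submodule.subsingleton_iff_eq_bot, ← Finite.card_le_one_iff_subsingleton, hcard]
    constructor
    · intro h; simp [h]
    · intro h
      by_contra hm
      exact absurd (one_lt_pow₀ hQ hm) (not_lt.2 h)
  · rw [card_intertwiners_rootEnd]
    rcases le_or_gt d (Module.finrank (AdjoinRoot φ) (LinearMap.ker (aeval T φ))) with hd | hd
    · rw [card_linearIndependent hd, ← Nat.card_eq_fintype_card,
        Fin.prod_univ_eq_prod_range (fun k => Nat.card (AdjoinRoot φ) ^ _ - Nat.card (AdjoinRoot φ) ^ k),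
        Nat.cast_prod]
      refine Finset.prod_congr rfl fun k hk => ?_
      rw [Nat.cast_sub (Nat.pow_le_pow_right hQ.le ((Finset.mem_range.1 hk).le.trans hd))]
      push_cast; rfl
    -- When `d` exceeds the dimension `m`, the factor `k = m` vanishes, matching the absence of
    -- independent `d`-tuples.
    · rw [Finset.prod_eq_zero (Finset.mem_range.2 hd) (sub_self _), Nat.cast_eq_zero,
        Nat.card_eq_zero]
      left
      refine ⟨fun s => ?_⟩
      have := s.2.fintype_card_le_finrank
      rw [Fintype.card_fin] at this
      omega

end KernelModule

/-! ### Several irreducibles at once. -/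

section Primary

variable {F V : Type u} [Field F] [AddCommGroup V] [Module F V] {ι : Type*} [Fintype ι]

theorem eq_zero_of_sum_eq_zero_of_mem_ker {T : V →ₗ[F] V} {φ : ι → F[X]}
    (hφ : Pairwise fun i j => IsCoprime (φ i) (φ j)) {v : ι → V}
    (hv : ∀ i, aeval T (φ i) (v i) = 0) (hsum : ∑ i, v i = 0) (i : ι) : v i = 0 := by
  classical
  have hcop : IsCoprime (φ i) (∏ j ∈ Finset.univ.erase i, φ j) :=
    IsCoprime.prod_right fun j hj => hφ (Finset.ne_of_mem_erase hj).symm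
  have h1 : ∀ j ∈ Finset.univ.erase i, aeval T (∏ j ∈ Finset.univ.erase i, φ j) (v j) = 0 := by
    intro j hj
    rw [← Finset.prod_erase_mul _ _ hj, map_mul, Module.End.mul_apply, hv, map_zero]
  have h2 : aeval T (∏ j ∈ Finset.univ.erase i, φ j) (v i) = 0 := by
    have h3 := congrArg (aeval T (∏ j ∈ Finset.univ.erase i, φ j)) hsum
    rwa [← Finset.sum_erase_add _ _ (Finset.mem_univ i), map_add, map_sum, Finset.sum_eq_zero h1,
      zero_add, map_zero] at h3
  obtain ⟨a, b, hab⟩ := hcop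
  have h4 := DFunLike.congr_fun (congrArg (aeval T) hab) (v i)
  rwa [map_add, LinearMap.add_apply, map_mul, map_mul, Module.End.mul_apply, Module.End.mul_apply,
    hv, h2, map_zero, map_zero, add_zero, map_one, Module.End.one_apply, eq_comm] at h4

variable (φ : ι → F[X])

/-- Multiplication by `X` on `∏ i, (F[X] / φ i) ^ (d i)`. -/
def multiRootEnd {ι : Type*} (φ : ι → F[X]) (d : ι → ℕ) :
    (∀ i, Fin (d i) → AdjoinRoot (φ i)) →ₗ[F] ∀ i, Fin (d i) → AdjoinRoot (φ i) :=
  piEnd fun i => rootEnd (φ i) (d i)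

/-- Kernels of pairwise coprime polynomials in `T` are independent, so a map out of the direct sum
is injective as soon as each restriction is. -/
theorem card_intertwiners_multiRootEnd (hφ : Pairwise fun i j => IsCoprime (φ i) (φ j))
    (d : ι → ℕ) (T : V →ₗ[F] V) :
    Nat.card (Intertwiners (multiRootEnd φ d) T) =
      ∏ i, Nat.card (Intertwiners (rootEnd (φ i) (d i)) T) := by
  classical
  rw [← Nat.card_pi]
  have hcomm : ∀ f ∈ Intertwiners (multiRootEnd φ d) T, ∀ i,
      f ∘ₗ LinearMap.single F _ i ∈ Intertwiners (rootEnd (φ i) (d i)) T := by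
    intro f hf i
    refine ⟨hf.1.comp (Pi.single_injective (M := fun i => Fin (d i) → AdjoinRoot (φ i)) i), ?_⟩
    refine LinearMap.ext fun x => ?_
    have h1 := DFunLike.congr_fun hf.2 (Pi.single i x)
    rw [LinearMap.comp_apply, LinearMap.comp_apply, multiRootEnd, piEnd_single] at h1
    exact h1
  refine Nat.card_eq_of_bijective
    (fun f i => ⟨f.1 ∘ₗ LinearMap.single F
      (fun i => Fin (d i) → AdjoinRoot (φ i)) i, hcomm f.1 f.2 i⟩) ⟨?_, ?_⟩
  · intro f g h
    refine Subtype.ext (LinearMap.pi_ext' fun i => ?_)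
    exact congrArg Subtype.val (congrFun h i)
  · intro g
    let f : (∀ i, Fin (d i) → AdjoinRoot (φ i)) →ₗ[F] V := ∑ i, (g i).1 ∘ₗ LinearMap.proj i
    have hf : ∀ x, f x = ∑ i, (g i).1 (x i) := fun x => by simp [f, LinearMap.sum_apply]
    refine ⟨⟨f, ?_, ?_⟩, ?_⟩
    · rw [← LinearMap.ker_eq_bot, LinearMap.ker_eq_bot']
      intro x hx
      rw [hf] at hx
      ext1 i
      refine (g i).2.1 ?_
      rw [Pi.zero_apply, map_zero]
      refine eq_zero_of_sum_eq_zero_of_mem_ker (T := T) hφ (fun j => ?_) hx i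
      rw [aeval_apply_of_comp_eq (g j).2.2, aeval_rootEnd_apply, AdjoinRoot.mk_self, zero_smul,
        map_zero]
    · refine LinearMap.ext fun x => ?_
      rw [LinearMap.comp_apply, LinearMap.comp_apply, hf, hf, map_sum]
      exact Finset.sum_congr rfl fun i _ => DFunLike.congr_fun (g i).2.2 (x i)
    · funext i
      refine Subtype.ext (LinearMap.ext fun x => ?_)
      change f (Pi.single i x) = (g i).1 x
      rw [hf, Finset.sum_eq_single i (fun j _ hj => by rw [Pi.single_eq_of_ne hj, map_zero])
        (by simp), Pi.single_eq_same]

/-- Moebius inversion over the semisimple submodules of `V`. -/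
theorem sum_piFinset_card_intertwiners [Finite F] [FiniteDimensional F V] [DecidableEq ι]
    [∀ i, Fact (Irreducible (φ i))] (hφ : Pairwise fun i j => IsCoprime (φ i) (φ j))
    (T : V →ₗ[F] V) {N : ℕ} (hN : Module.finrank F V ≤ N) [Decidable (∀ i, LinearMap.ker (aeval T (φ i)) = ⊥)] :
    ∑ d ∈ Fintype.piFinset fun _ : ι => Finset.range (N + 1),
      (∏ i, (-1) ^ d i / qFac (Nat.card (AdjoinRoot (φ i))) (d i)) *
        (Nat.card (Intertwiners (multiRootEnd φ d) T) : ℝ) =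
      if ∀ i, LinearMap.ker (aeval T (φ i)) = ⊥ then 1 else 0 := by
  choose m hm hm0 hcard using fun i => card_intertwiners_rootEnd_eq_prod T (φ i)
  have hQ : ∀ i, (1 : ℝ) < Nat.card (AdjoinRoot (φ i)) := fun i => by
    have hφ : φ i ≠ 0 := (Fact.out : Irreducible (φ i)).ne_zero
    have : FiniteDimensional F (AdjoinRoot (φ i)) := (AdjoinRoot.powerBasis hφ).finite
    have : Finite (AdjoinRoot (φ i)) := Module.finite_of_finite F
    exact_mod_cast Finite.one_lt_card
  have h1 : ∀ d : ι → ℕ, (∏ i, (-1) ^ d i / qFac (Nat.card (AdjoinRoot (φ i))) (d i)) *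
        (Nat.card (Intertwiners (multiRootEnd φ d) T) : ℝ) =
      ∏ i, ((-1) ^ d i / qFac (Nat.card (AdjoinRoot (φ i))) (d i) * ∏ k ∈ Finset.range (d i),
        ((Nat.card (AdjoinRoot (φ i)) : ℝ) ^ m i - (Nat.card (AdjoinRoot (φ i))) ^ k)) := by
    intro d
    rw [card_intertwiners_multiRootEnd φ hφ, Nat.cast_prod, ← Finset.prod_mul_distrib]
    exact Finset.prod_congr rfl fun i _ => by rw [hcard]
  rw [Finset.sum_congr rfl fun d _ => h1 d, ← Finset.prod_univ_sum (fun _ => Finset.range (N + 1))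
      (fun i k => (-1) ^ k / qFac (Nat.card (AdjoinRoot (φ i))) k * ∏ l ∈ Finset.range k,
        ((Nat.card (AdjoinRoot (φ i)) : ℝ) ^ m i - (Nat.card (AdjoinRoot (φ i))) ^ l)),
    Finset.prod_congr rfl fun i _ =>
      sum_range_neg_one_pow_prod_div_qFac_eq_ite (hQ i) ((hm i).trans hN)]
  simp only [hm0, Finset.prod_ite_zero, Finset.prod_const_one, Finset.mem_univ, true_implies]

end Primary

/-! ### Reversal and conjugation of irreducible polynomials. -/

section Conjugates

variable {F : Type u} [Field F] {φ ψ : F[X]}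

theorem natDegree_reverse_eq (h : φ.coeff 0 ≠ 0) : φ.reverse.natDegree = φ.natDegree := by
  rw [reverse_natDegree, natTrailingDegree_eq_zero.2 (Or.inr h), Nat.sub_zero]

theorem reverse_reverse_eq (h : φ.coeff 0 ≠ 0) : φ.reverse.reverse = φ := by
  ext n
  rw [coeff_reverse, coeff_reverse, natDegree_reverse_eq h, revAt_invol]

theorem irreducible_reverse (h : φ.coeff 0 ≠ 0) (hφ : Irreducible φ) : Irreducible φ.reverse := by
  have hz : φ.reverse.coeff 0 ≠ 0 := by
    rw [coeff_zero_reverse]; exact leadingCoeff_ne_zero.2 hφ.ne_zero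
  have key : ∀ a : F[X], a.coeff 0 ≠ 0 → IsUnit a.reverse → IsUnit a := by
    intro a ha hu
    have h1 := natDegree_eq_zero_of_isUnit hu
    rw [natDegree_reverse_eq ha] at h1
    rw [eq_C_of_natDegree_eq_zero h1]
    exact isUnit_C.2 (isUnit_iff_ne_zero.2 ha)
  refine ⟨fun hu => hφ.not_isUnit (key _ h hu), fun a b hab => ?_⟩
  have h2 := congrArg (fun p => coeff p 0) hab
  simp only [mul_coeff_zero] at h2
  have ha : a.coeff 0 ≠ 0 := fun h0 => hz (by rw [h2, h0, zero_mul])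
  have hb : b.coeff 0 ≠ 0 := fun h0 => hz (by rw [h2, h0, mul_zero])
  have h3 := congrArg reverse hab
  rw [reverse_reverse_eq h, reverse_mul_of_domain] at h3
  exact (hφ.isUnit_or_isUnit h3).imp (key a ha) (key b hb)

/-- Monic irreducible polynomials other than `X`. -/
def IsGoodPoly (φ : F[X]) : Prop := φ.Monic ∧ Irreducible φ ∧ φ.coeff 0 ≠ 0

theorem natDegree_conjPoly (h : φ.coeff 0 ≠ 0) : (conjPoly φ).natDegree = φ.natDegree := by
  rw [conjPoly, natDegree_C_mul (inv_ne_zero h), natDegree_reverse_eq h]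

theorem associated_conjPoly (h : φ.coeff 0 ≠ 0) : Associated φ.reverse (conjPoly φ) := by
  rw [conjPoly, mul_comm]
  exact associated_mul_unit_right _ _ (isUnit_C.2 (isUnit_iff_ne_zero.2 (inv_ne_zero h)))

theorem monic_conjPoly (h : φ.coeff 0 ≠ 0) : (conjPoly φ).Monic := by
  rw [Monic, conjPoly, leadingCoeff_mul, leadingCoeff_C, reverse_leadingCoeff, trailingCoeff,
    natTrailingDegree_eq_zero.2 (Or.inr h), inv_mul_cancel₀ h]

theorem coeff_zero_conjPoly (h : φ.Monic) : (conjPoly φ).coeff 0 = (φ.coeff 0)⁻¹ := by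
  rw [conjPoly, mul_coeff_zero, coeff_C_zero, coeff_zero_reverse, h.leadingCoeff, mul_one]

theorem IsGoodPoly.conjPoly (h : IsGoodPoly φ) : IsGoodPoly (conjPoly φ) :=
  ⟨monic_conjPoly h.2.2, (associated_conjPoly h.2.2).irreducible (irreducible_reverse h.2.2 h.2.1),
    by rw [coeff_zero_conjPoly h.1]; exact inv_ne_zero h.2.2⟩

theorem conjPoly_conjPoly (hm : φ.Monic) (h : φ.coeff 0 ≠ 0) : conjPoly (conjPoly φ) = φ := by
  conv_lhs => rw [conjPoly]
  rw [coeff_zero_conjPoly hm, inv_inv, conjPoly, reverse_mul_of_domain, reverse_C,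
    reverse_reverse_eq h, ← mul_assoc, ← C_mul, mul_inv_cancel₀ h, C_1, one_mul]

theorem IsGoodPoly.isCoprime (hφ : IsGoodPoly φ) (hψ : IsGoodPoly ψ) (h : φ ≠ ψ) :
    IsCoprime φ ψ := by
  refine (hφ.2.1.coprime_iff_not_dvd).2 fun hd => h ?_
  exact eq_of_monic_of_associated hφ.1 hψ.1 (hφ.2.1.associated_of_dvd hψ.2.1 hd)

theorem IsGoodPoly.isCoprime_reverse (hφ : IsGoodPoly φ) (hψ : IsGoodPoly ψ)
    (h : _root_.conjPoly φ ≠ ψ) : IsCoprime φ.reverse ψ :=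
  (hφ.conjPoly.isCoprime hψ h).of_isCoprime_of_dvd_left (associated_conjPoly hφ.2.2).dvd

theorem root_ne_zero_of_isGoodPoly [Fact (Irreducible φ)] (h : IsGoodPoly φ) :
    AdjoinRoot.root φ ≠ 0 := by
  intro h0
  have h1 := AdjoinRoot.eval₂_root φ
  rw [h0, eval₂_at_zero] at h1
  exact h.2.2 ((map_eq_zero _).1 h1)

/-- The automorphism of `F[X] / φ` inverting the root, for `φ` self-conjugate. -/
theorem exists_algHom_root_eq_inv [Fact (Irreducible φ)] (h : IsGoodPoly φ) (hc : conjPoly φ = φ) :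
    ∃ σ : AdjoinRoot φ →ₐ[F] AdjoinRoot φ, σ (AdjoinRoot.root φ) = (AdjoinRoot.root φ)⁻¹ := by
  have h0 := root_ne_zero_of_isGoodPoly h
  let := invertibleOfNonzero h0
  have h1 : φ.eval₂ (Algebra.ofId F (AdjoinRoot φ) : F →+* AdjoinRoot φ)
      (AdjoinRoot.root φ)⁻¹ = 0 := by
    have h2 := (eval₂_reverse_eq_zero_iff (AdjoinRoot.of φ) (AdjoinRoot.root φ) φ).2
      (AdjoinRoot.eval₂_root φ)
    rw [invOf_eq_inv] at h2
    have h3 : (conjPoly φ).eval₂ (Algebra.ofId F (AdjoinRoot φ) : F →+* AdjoinRoot φ)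
        (AdjoinRoot.root φ)⁻¹ = 0 := by
      rw [conjPoly, eval₂_mul]
      exact mul_eq_zero_of_right _ h2
    exact (congrArg (eval₂ _ _) hc).symm.trans h3
  refine ⟨AdjoinRoot.liftAlgHom φ (Algebra.ofId F _) _ h1, AdjoinRoot.lift_root h1⟩

theorem finrank_adjoinRoot (h : φ ≠ 0) : Module.finrank F (AdjoinRoot φ) = φ.natDegree := by
  rw [(AdjoinRoot.powerBasis h).finrank, AdjoinRoot.powerBasis_dim]

theorem finiteDimensional_adjoinRoot (h : φ ≠ 0) : FiniteDimensional F (AdjoinRoot φ) :=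
  (AdjoinRoot.powerBasis h).finite

/-- A root equal to its inverse is `1` or `-1`, hence lies in `F`. -/
theorem natDegree_eq_one_of_root_eq_inv [Fact (Irreducible φ)] (h : IsGoodPoly φ)
    (hr : (AdjoinRoot.root φ)⁻¹ = AdjoinRoot.root φ) : φ.natDegree = 1 := by
  have h0 := root_ne_zero_of_isGoodPoly h
  have h1 : AdjoinRoot.root φ * AdjoinRoot.root φ = 1 := by
    have := inv_mul_cancel₀ h0
    rwa [hr] at this
  have h2 : ∃ a : F, AdjoinRoot.mk φ (X - C a) = 0 := by
    rcases mul_self_eq_one_iff.1 h1 with h3 | h3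
    · exact ⟨1, by simp [h3]⟩
    · exact ⟨-1, by simp [h3]⟩
  obtain ⟨a, ha⟩ := h2
  rw [AdjoinRoot.mk_eq_zero] at ha
  have h3 := natDegree_le_of_dvd ha (X_sub_C_ne_zero a)
  rw [natDegree_X_sub_C] at h3
  have h4 := h.2.1.natDegree_pos
  omega

end Conjugates

/-! ### The number of invariant alternating forms on each component. -/

section CountForms

variable {F : Type u} [Field F]

/-- The number of invariant alternating forms on `F[X] / φ`. -/
def formCount (φ : F[X]) : ℕ :=
  Nat.card (InvAltForms (LinearMap.mulLeft F (AdjoinRoot.root φ)))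

open scoped Classical in
/-- The number of invariant alternating forms on `(F[X] / φ) ^ d`. -/
def localCount (φ : F[X]) (d : ℕ) : ℕ :=
  if conjPoly φ = φ then Nat.card (AdjoinRoot φ) ^ d.choose 2 * formCount φ ^ d else 1

/-- An alternating form on a line is zero. In degree above one, inverting the root is a nontrivial
involution of the field, so the degree is even. -/
theorem formCount_eq [Finite F] (φ : F[X]) [Fact (Irreducible φ)] (h : IsGoodPoly φ) (hc : conjPoly φ = φ) :
    (φ.natDegree = 1 ∧ formCount φ = 1) ∨
      ∃ j, 1 ≤ j ∧ φ.natDegree = 2 * j ∧ formCount φ = Nat.card F ^ j := by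
  have := finiteDimensional_adjoinRoot h.2.1.ne_zero
  have hf := finrank_adjoinRoot h.2.1.ne_zero
  by_cases h1 : φ.natDegree = 1
  · exact Or.inl ⟨h1, card_invAltForms_of_finrank_eq_one (by rw [hf, h1]) _⟩
  · obtain ⟨σ, hσ⟩ := exists_algHom_root_eq_inv h hc
    obtain ⟨j, hj, hcard⟩ := card_invAltForms_of_involution (root_ne_zero_of_isGoodPoly h)
      (AdjoinRoot.adjoinRoot_eq_top) hσ (fun hr => h1 (natDegree_eq_one_of_root_eq_inv h hr))
    refine Or.inr ⟨j, ?_, hf.symm.trans hj, hcard⟩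
    have := h.2.1.natDegree_pos
    omega

theorem card_adjoinRoot {φ : F[X]} (h : φ ≠ 0) :
    Nat.card (AdjoinRoot φ) = Nat.card F ^ φ.natDegree := by
  have := finiteDimensional_adjoinRoot h
  rw [Module.natCard_eq_pow_finrank (K := F), finrank_adjoinRoot h]

theorem invForms_rootEnd_eq_zero {φ ψ : F[X]} (hφ : IsGoodPoly φ) (hψ : IsGoodPoly ψ)
    (h : conjPoly φ ≠ ψ) {d e : ℕ}
    {b : (Fin d → AdjoinRoot φ) →ₗ[F] (Fin e → AdjoinRoot ψ) →ₗ[F] F}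
    (hb : b ∈ InvForms (rootEnd φ d) (rootEnd ψ e)) : b = 0 := by
  refine InvForms.eq_zero_of_isCoprime hb ?_ ?_ (hφ.isCoprime_reverse hψ h)
  · refine LinearMap.ext fun x => ?_
    rw [aeval_rootEnd_apply, AdjoinRoot.mk_self, zero_smul, LinearMap.zero_apply]
  · refine LinearMap.ext fun x => ?_
    rw [aeval_rootEnd_apply, AdjoinRoot.mk_self, zero_smul, LinearMap.zero_apply]

theorem card_invForms_mulLeft_root (φ : F[X]) [Fact (Irreducible φ)] (h : IsGoodPoly φ)
    (hc : conjPoly φ = φ) :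
    Nat.card (InvForms (LinearMap.mulLeft F (AdjoinRoot.root φ))
      (LinearMap.mulLeft F (AdjoinRoot.root φ))) = Nat.card (AdjoinRoot φ) := by
  have := finiteDimensional_adjoinRoot h.2.1.ne_zero
  obtain ⟨σ, hσ⟩ := exists_algHom_root_eq_inv h hc
  rw [Nat.card_congr (invFormsEquivDual (root_ne_zero_of_isGoodPoly h)
    (AdjoinRoot.adjoinRoot_eq_top) hσ), Module.natCard_eq_pow_finrank (K := F),
    Module.natCard_eq_pow_finrank (K := F) (V := AdjoinRoot φ), Subspace.dual_finrank_eq]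

/-- For self-conjugate `φ` each of the `d` diagonal blocks is an alternating form and each of the `d
choose 2` blocks above the diagonal is an arbitrary invariant form, with `|F[X]/φ|` choices.
Otherwise `φ.reverse` is coprime to `φ` and only the zero form survives. -/
theorem card_invAltForms_rootEnd (φ : F[X]) [Fact (Irreducible φ)] (h : IsGoodPoly φ) (d : ℕ) :
    Nat.card (InvAltForms (rootEnd φ d)) = localCount φ d := by
  by_cases hc : conjPoly φ = φ
  · rw [rootEnd, card_invAltForms_piEnd, card_invForms_mulLeft_root φ h hc, Finset.prod_const,
      Finset.prod_const, Finset.card_univ, Finset.card_univ, card_subtype_fst_lt_snd,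
      Fintype.card_fin, localCount, if_pos hc, mul_comm]
    rfl
  · rw [localCount, if_neg hc, Nat.card_eq_one_iff_unique]
    have key : ∀ b : InvAltForms (rootEnd φ d), b.1 = 0 := fun b =>
      invForms_rootEnd_eq_zero h h hc b.2.2
    exact ⟨⟨fun b c => Subtype.ext ((key b).trans (key c).symm)⟩,
      ⟨⟨0, fun x => rfl, fun x y => rfl⟩⟩⟩

theorem card_invAltForms_multiRootEnd {ι : Type*} [Fintype ι] (φ : ι → F[X])
    [∀ i, Fact (Irreducible (φ i))] (h : ∀ i, IsGoodPoly (φ i))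
    (hφ : Pairwise fun i j => conjPoly (φ i) ≠ φ j) (d : ι → ℕ) :
    Nat.card (InvAltForms (multiRootEnd φ d)) = ∏ i, localCount (φ i) (d i) := by
  -- An arbitrary order, only to list each off-diagonal pair of components once.
  let : LinearOrder ι := LinearOrder.lift' (Fintype.equivFin ι) (Fintype.equivFin ι).injective
  rw [multiRootEnd, card_invAltForms_piEnd, Finset.prod_eq_one (s := Finset.univ
    (α := {p : ι × ι // p.1 < p.2})), mul_one]
  · exact Finset.prod_congr rfl fun i _ => card_invAltForms_rootEnd (φ i) (h i) (d i)
  · intro p _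
    rw [Nat.card_eq_one_iff_unique]
    have key : ∀ b : InvForms (rootEnd (φ p.1.1) (d p.1.1)) (rootEnd (φ p.1.2) (d p.1.2)),
        b.1 = 0 := fun b => invForms_rootEnd_eq_zero (h _) (h _) (hφ p.2.ne) b.2
    exact ⟨⟨fun b c => Subtype.ext ((key b).trans (key c).symm)⟩, ⟨⟨0, fun x y => rfl⟩⟩⟩

theorem multiRootEnd_injective {ι : Type*} (φ : ι → F[X])
    [∀ i, Fact (Irreducible (φ i))] (h : ∀ i, IsGoodPoly (φ i)) (d : ι → ℕ) :
    Function.Injective (multiRootEnd φ d) := by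
  intro x y hxy
  funext i k
  exact mul_left_cancel₀ (root_ne_zero_of_isGoodPoly (h i)) (congrFun (congrFun hxy i) k)

end CountForms

/-! ### The exact formula at finite `n` and its limit. -/

section Limit

variable {F : Type u} [Field F]

/-- The weight of `(F[X] / φ) ^ d` in the Moebius inversion. -/
def moebiusWeight (φ : F[X]) (d : ℕ) : ℝ := (-1) ^ d / qFac (Nat.card (AdjoinRoot φ)) d

/-- The number of invariant alternating forms on `∏ i, (F[X] / φ i) ^ (d i)` that embed in the
standard symplectic space of dimension `2 n`. -/
def embeddedCount {ι : Type u} (φ : ι → F[X]) (d : ι → ℕ) (n : ℕ) : ℕ :=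
  Nat.card {β // β ∈ InvAltForms (multiRootEnd φ d) ∧ (IsometricEmb β (standardForm F n)).Nonempty}

variable {ι : Type u} (φ : ι → F[X]) [∀ i, Fact (Irreducible (φ i))]

theorem embeddedCount_eq_zero {d : ι → ℕ} {n : ℕ} {i : ι} (hi : 2 * n < d i) :
    embeddedCount φ d n = 0 := by
  refine Nat.card_eq_zero.2 (Or.inl ⟨fun β => ?_⟩)
  obtain ⟨f, hf, -⟩ := β.2.2
  classical
  have hφ := (Fact.out : Irreducible (φ i))
  have := finiteDimensional_adjoinRoot hφ.ne_zero
  have h1 := LinearMap.finrank_le_finrank_of_injective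
    (f := f ∘ₗ LinearMap.single F (fun i => Fin (d i) → AdjoinRoot (φ i)) i)
    (hf.comp (Pi.single_injective (M := fun i => Fin (d i) → AdjoinRoot (φ i)) i))
  rw [Module.finrank_pi_fintype, finrank_adjoinRoot hφ.ne_zero] at h1
  simp only [Finset.sum_const, Finset.card_univ, Fintype.card_fin, smul_eq_mul,
    Module.finrank_fintype_fun_eq_card, Fintype.card_sum] at h1
  have h2 := hφ.natDegree_pos
  nlinarith

variable [Fintype ι]

theorem finiteDimensional_pi_adjoinRoot (d : ι → ℕ) :
    FiniteDimensional F (∀ i, Fin (d i) → AdjoinRoot (φ i)) := by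
  have : ∀ i, FiniteDimensional F (AdjoinRoot (φ i)) := fun i =>
    finiteDimensional_adjoinRoot (Fact.out : Irreducible (φ i)).ne_zero
  infer_instance

theorem embeddedCount_eq (d : ι → ℕ) {n : ℕ}
    (hn : Module.finrank F (∀ i, Fin (d i) → AdjoinRoot (φ i)) ≤ n) :
    embeddedCount φ d n = Nat.card (InvAltForms (multiRootEnd φ d)) := by
  have := finiteDimensional_pi_adjoinRoot φ d
  exact Nat.card_congr (Equiv.subtypeEquivRight fun β =>
    ⟨fun h => h.1, fun h => ⟨h, isometricEmb_standardForm_nonempty h.1 hn⟩⟩)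

variable [Finite F]

theorem embeddedCount_le (d : ι → ℕ) (n : ℕ) :
    embeddedCount φ d n ≤ Nat.card (InvAltForms (multiRootEnd φ d)) := by
  have := finiteDimensional_pi_adjoinRoot φ d
  have : Finite (LinearMap.BilinForm F (∀ i, Fin (d i) → AdjoinRoot (φ i))) :=
    Module.finite_of_finite F
  exact Nat.card_le_card_of_injective (fun β => (⟨β.1, β.2.1⟩ : InvAltForms (multiRootEnd φ d)))
    fun β γ h => Subtype.ext (Subtype.mk.inj h)

theorem card_isometrySet_ker_eq_bot (h : ∀ i, IsGoodPoly (φ i)) (hinj : Function.Injective φ)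
    (n : ℕ) :
    (Nat.card {T : (Fin n ⊕ Fin n → F) →ₗ[F] (Fin n ⊕ Fin n → F) //
        T ∈ IsometrySet (standardForm F n) ∧ ∀ i, LinearMap.ker (aeval T (φ i)) = ⊥} : ℝ) =
      Nat.card (IsometrySet (standardForm F n)) *
        ∑' d : ι → ℕ, (∏ i, moebiusWeight (φ i) (d i)) * embeddedCount φ d n := by
  classical
  have : Finite ((Fin n ⊕ Fin n → F) →ₗ[F] (Fin n ⊕ Fin n → F)) := finite_linearMap
  have := Fintype.ofFinite (IsometrySet (standardForm F n))
  have hfr : Module.finrank F (Fin n ⊕ Fin n → F) ≤ 2 * n := by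
    rw [Module.finrank_fintype_fun_eq_card, Fintype.card_sum, Fintype.card_fin]; omega
  have e1 : (Nat.card {T : (Fin n ⊕ Fin n → F) →ₗ[F] (Fin n ⊕ Fin n → F) //
        T ∈ IsometrySet (standardForm F n) ∧ ∀ i, LinearMap.ker (aeval T (φ i)) = ⊥} : ℝ) =
      ∑ T : IsometrySet (standardForm F n),
        if ∀ i, LinearMap.ker (aeval T.1 (φ i)) = ⊥ then (1 : ℝ) else 0 := by
    rw [Finset.sum_boole, ← Fintype.card_subtype, ← Nat.card_eq_fintype_card]
    norm_cast
    exact Nat.card_congr (Equiv.subtypeSubtypeEquivSubtypeInter (· ∈ IsometrySet (standardForm F n))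
      (fun T => ∀ i, LinearMap.ker (aeval T (φ i)) = ⊥)).symm
  have e2 : ∀ d : ι → ℕ, ∑ T : IsometrySet (standardForm F n),
      (Nat.card (Intertwiners (multiRootEnd φ d) T.1) : ℝ) =
        embeddedCount φ d n * Nat.card (IsometrySet (standardForm F n)) := by
    intro d
    have := finiteDimensional_pi_adjoinRoot φ d
    have h1 := card_isometry_intertwining (standardForm_injective F n) (standardForm_isAlt F n)
      (multiRootEnd_injective φ h d)
    have : ∀ T : IsometrySet (standardForm F n), Finite {f : (∀ i, Fin (d i) → AdjoinRoot (φ i))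
        →ₗ[F] (Fin n ⊕ Fin n → F) // Function.Injective f ∧ T.1 ∘ₗ f = f ∘ₗ multiRootEnd φ d} :=
      fun T => by
        have : Finite ((∀ i, Fin (d i) → AdjoinRoot (φ i)) →ₗ[F] (Fin n ⊕ Fin n → F)) :=
          finite_linearMap
        infer_instance
    rw [Nat.card_sigma] at h1
    rw [← Nat.cast_sum, ← Nat.cast_mul]
    exact congrArg Nat.cast h1
  -- Expand each indicator by inversion and exchange the sums. The infinite sum is really finite: no
  -- form embeds when some multiplicity exceeds `2 n`, the dimension of the space.
  rw [e1, Finset.sum_congr rfl fun T _ => (sum_piFinset_card_intertwiners φ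
    (fun i j hij => (h i).isCoprime (h j) (hinj.ne hij)) T.1 hfr).symm, Finset.sum_comm,
    tsum_eq_sum (s := Fintype.piFinset fun _ : ι => Finset.range (2 * n + 1)), Finset.mul_sum]
  · refine Finset.sum_congr rfl fun d _ => ?_
    rw [← Finset.mul_sum, e2]
    simp only [moebiusWeight]
    ring
  · intro d hd
    simp only [Fintype.mem_piFinset, Finset.mem_range, not_forall, not_lt] at hd
    obtain ⟨i, hi⟩ := hd
    rw [embeddedCount_eq_zero φ (i := i) (by omega), Nat.cast_zero, mul_zero]

/-- Each term is eventually constant in `n` and always dominated by its eventual value, since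
embedded forms are among all invariant forms; those eventual values are absolutely summable because
they factor over `ι`. -/
theorem tendsto_proportion_ker_eq_bot (h : ∀ i, IsGoodPoly (φ i)) (hinj : Function.Injective φ)
    (hφ : Pairwise fun i j => conjPoly (φ i) ≠ φ j)
    (hs : ∀ i, Summable fun k => ‖moebiusWeight (φ i) k * localCount (φ i) k‖) :
    Tendsto (fun n : ℕ => (Nat.card {T : (Fin n ⊕ Fin n → F) →ₗ[F] (Fin n ⊕ Fin n → F) //
        T ∈ IsometrySet (standardForm F n) ∧ ∀ i, LinearMap.ker (aeval T (φ i)) = ⊥} : ℝ) /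
      Nat.card (IsometrySet (standardForm F n))) atTop
      (𝓝 (∏ i, ∑' k, moebiusWeight (φ i) k * localCount (φ i) k)) := by
  have hpos : ∀ n, (Nat.card (IsometrySet (standardForm F n)) : ℝ) ≠ 0 := by
    intro n
    have : Finite ((Fin n ⊕ Fin n → F) →ₗ[F] (Fin n ⊕ Fin n → F)) := finite_linearMap
    have : Nonempty (IsometrySet (standardForm F n)) := ⟨⟨LinearMap.id, fun x y => rfl⟩⟩
    exact_mod_cast Nat.card_pos.ne'
  have e : ∀ d : ι → ℕ, (∏ i, moebiusWeight (φ i) (d i)) *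
      (Nat.card (InvAltForms (multiRootEnd φ d)) : ℝ) =
        ∏ i, moebiusWeight (φ i) (d i) * localCount (φ i) (d i) := by
    intro d
    rw [card_invAltForms_multiRootEnd φ h hφ, Nat.cast_prod, Finset.prod_mul_distrib]
  rw [← tsum_prod_pi _ hs]
  refine Tendsto.congr (fun n => ?_) (tendsto_tsum_of_dominated_convergence
    (f := fun n (d : ι → ℕ) => (∏ i, moebiusWeight (φ i) (d i)) * (embeddedCount φ d n : ℝ))
    (summable_norm_prod_pi _ hs) (fun d => ?_) (Eventually.of_forall fun n d => ?_))
  · rw [card_isometrySet_ker_eq_bot φ h hinj, mul_div_cancel_left₀ _ (hpos n)]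
  · refine tendsto_const_nhds.congr' ?_
    filter_upwards [eventually_ge_atTop
      (Module.finrank F (∀ i, Fin (d i) → AdjoinRoot (φ i)))] with n hn
    rw [← e, embeddedCount_eq φ d hn]
  · rw [← e, norm_mul, norm_mul, Real.norm_natCast, Real.norm_natCast]
    gcongr
    exact embeddedCount_le φ d n

end Limit

/-! ### From factors of the characteristic polynomial to kernels. -/

section CharacteristicPolynomial

variable {F : Type u} [Field F] {m : Type*} [Fintype m] [DecidableEq m]

theorem isUnit_aeval_matrix_iff (A : Matrix m m F) (φ : F[X]) :
    IsUnit (aeval A φ) ↔ LinearMap.ker (aeval (Matrix.toLin' A) φ) = ⊥ := by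
  rw [← LinearMap.isUnit_iff_ker_eq_bot]
  have : aeval (Matrix.toLin' A) φ = Matrix.toLinAlgEquiv' (aeval A φ) :=
    aeval_algHom_apply (Matrix.toLinAlgEquiv' : Matrix m m F ≃ₐ[F] _).toAlgHom A φ
  rw [this, MulEquiv.isUnit_map]

/-- If `φ` divides, its root in `F[X]/φ` is an eigenvalue after base change, so `φ(A)` is singular.
If not, a Bézout relation and Cayley-Hamilton invert `φ(A)`. -/
theorem irreducible_dvd_charpoly_iff (A : Matrix m m F) {φ : F[X]} (hφ : Irreducible φ) :
    φ ∣ A.charpoly ↔ LinearMap.ker (aeval (Matrix.toLin' A) φ) ≠ ⊥ := by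
  rw [Ne, ← isUnit_aeval_matrix_iff]
  constructor
  · intro hd hu
    have : Fact (Irreducible φ) := ⟨hφ⟩
    let f : Matrix m m F →ₐ[F] Matrix m m (AdjoinRoot φ) :=
      (Algebra.ofId F (AdjoinRoot φ)).mapMatrix
    have h1 : (f A).charpoly.IsRoot (AdjoinRoot.root φ) := by
      have h2 : (f A).charpoly = A.charpoly.map (algebraMap F (AdjoinRoot φ)) :=
        Matrix.charpoly_map A (algebraMap F (AdjoinRoot φ))
      rw [h2, IsRoot, eval_map_algebraMap, AdjoinRoot.aeval_eq, AdjoinRoot.mk_eq_zero]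
      exact hd
    rw [← Matrix.mem_spectrum_iff_isRoot_charpoly] at h1
    have h3 := spectrum.subset_polynomial_aeval (f A) (φ.map (algebraMap F (AdjoinRoot φ)))
      ⟨_, h1, rfl⟩
    dsimp only at h3
    rw [eval_map_algebraMap, AdjoinRoot.aeval_eq, AdjoinRoot.mk_self, aeval_map_algebraMap,
      aeval_algHom_apply] at h3
    exact spectrum.zero_notMem (AdjoinRoot φ) (hu.map f) h3
  · intro h
    by_contra hd
    obtain ⟨a, b, hab⟩ := hφ.coprime_iff_not_dvd.2 hd
    refine h (IsUnit.of_mul_eq_one (aeval A a) ?_)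
    have h1 := congrArg (aeval A) hab
    rw [map_add, map_mul, map_mul, Matrix.aeval_self_charpoly, mul_zero, add_zero, map_one] at h1
    rw [← map_mul, mul_comm, map_mul, h1]

/-- A vector killed by `φ(T)` is orthogonal to the image of the conjugate polynomial of `T`, which
therefore cannot be everything. -/
theorem ker_aeval_conjPoly_ne_bot {V : Type u} [AddCommGroup V] [Module F V]
    [FiniteDimensional F V] {B : LinearMap.BilinForm F V} (hB : Function.Injective B)
    {T : V →ₗ[F] V} (hT : T ∈ IsometrySet B) {φ : F[X]}
    (h : LinearMap.ker (aeval T φ) ≠ ⊥) : LinearMap.ker (aeval T (conjPoly φ)) ≠ ⊥ := by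
  intro hk
  obtain ⟨x, hx, hx0⟩ := Submodule.exists_mem_ne_zero_of_ne_bot h
  have hsurj : Function.Surjective (aeval T (conjPoly φ)) :=
    LinearMap.range_eq_top.1 (LinearMap.ker_eq_bot_iff_range_eq_top.1 hk)
  refine hx0 (hB (LinearMap.ext fun z => ?_))
  obtain ⟨y, rfl⟩ := hsurj z
  rw [conjPoly, mul_comm, map_mul, Module.End.mul_apply,
    ← InvForms.aeval_apply (X := T) (Y := T) (b := B) hT, LinearMap.mem_ker.1 hx]
  simp

theorem mem_symplecticGroup_iff_toLin' {n : ℕ} (A : Matrix (Fin n ⊕ Fin n) (Fin n ⊕ Fin n) F) :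
    A ∈ Matrix.symplecticGroup (Fin n) F ↔ Matrix.toLin' A ∈ IsometrySet (standardForm F n) := by
  rw [SymplecticGroup.mem_iff', ← (Matrix.toBilin' (R₁ := F)).injective.eq_iff,
    ← Matrix.toBilin'_comp]
  constructor
  · intro h x y
    exact DFunLike.congr_fun (DFunLike.congr_fun h x) y
  · intro h
    exact LinearMap.ext₂ h

theorem exists_isGoodPoly_dvd {f φ : F[X]} (hf : f.coeff 0 ≠ 0) (hφ : Irreducible φ) (hd : φ ∣ f) :
    ∃ ψ, IsGoodPoly ψ ∧ ψ ∣ f ∧ ψ.natDegree = φ.natDegree := by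
  have h0 := leadingCoeff_ne_zero.2 hφ.ne_zero
  have ha : Associated φ (φ * C φ.leadingCoeff⁻¹) :=
    associated_mul_unit_right _ _ (isUnit_C.2 (isUnit_iff_ne_zero.2 (inv_ne_zero h0)))
  have hd' := ha.dvd'.trans hd
  refine ⟨φ * C φ.leadingCoeff⁻¹, ⟨monic_mul_leadingCoeff_inv hφ.ne_zero, ha.irreducible hφ, ?_⟩,
    hd', natDegree_mul_C (inv_ne_zero h0)⟩
  intro hc
  obtain ⟨g, hg⟩ := hd'
  exact hf (by rw [hg, mul_coeff_zero, hc, zero_mul])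

theorem hasNoSmallFactor_iff {n t : ℕ} {A : Matrix (Fin n ⊕ Fin n) (Fin n ⊕ Fin n) F}
    (hA : A ∈ Matrix.symplecticGroup (Fin n) F) {S : Set F[X]}
    (hS : ∀ φ ∈ S, IsGoodPoly φ ∧ φ.natDegree ≤ t)
    (hS' : ∀ φ, IsGoodPoly φ → φ.natDegree ≤ t → φ ∈ S ∨ conjPoly φ ∈ S) :
    HasNoSmallFactor t A.charpoly ↔
      ∀ φ : S, LinearMap.ker (aeval (Matrix.toLin' A) φ.1) = ⊥ := by
  constructor
  · intro h φ
    by_contra hk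
    have h1 := h φ.1 (hS _ φ.2).1.2.1 ((irreducible_dvd_charpoly_iff A (hS _ φ.2).1.2.1).2 hk)
    exact absurd (hS _ φ.2).2 (not_le.2 h1)
  · intro h φ hφ hd
    by_contra! ht
    have h0 : A.charpoly.coeff 0 ≠ 0 := by
      have hu := SymplecticGroup.symplectic_det hA
      rw [Matrix.det_eq_sign_charpoly_coeff] at hu
      exact fun hc => hu.ne_zero (by rw [hc, mul_zero])
    obtain ⟨ψ, hψ, hψd, hdeg⟩ := exists_isGoodPoly_dvd h0 hφ hd
    have hk := (irreducible_dvd_charpoly_iff A hψ.2.1).1 hψd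
    rcases hS' ψ hψ (hdeg.trans_le ht) with h1 | h1
    · exact hk (h ⟨ψ, h1⟩)
    · exact ker_aeval_conjPoly_ne_bot (standardForm_injective F n)
        ((mem_symplecticGroup_iff_toLin' A).1 hA) hk (h ⟨_, h1⟩)

theorem spProportion_eq {t : ℕ} {S : Set F[X]}
    (hS : ∀ φ ∈ S, IsGoodPoly φ ∧ φ.natDegree ≤ t)
    (hS' : ∀ φ, IsGoodPoly φ → φ.natDegree ≤ t → φ ∈ S ∨ conjPoly φ ∈ S) (n : ℕ) :
    spProportion F t n = (Nat.card {T : (Fin n ⊕ Fin n → F) →ₗ[F] (Fin n ⊕ Fin n → F) //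
        T ∈ IsometrySet (standardForm F n) ∧ ∀ φ : S, LinearMap.ker (aeval T φ.1) = ⊥} : ℝ) /
      Nat.card (IsometrySet (standardForm F n)) := by
  rw [spProportion]
  have e1 : Matrix.symplecticGroup (Fin n) F ≃ IsometrySet (standardForm F n) :=
    (Matrix.toLin' (R := F)).toEquiv.subtypeEquiv mem_symplecticGroup_iff_toLin'
  have e2 : {A : Matrix.symplecticGroup (Fin n) F //
      HasNoSmallFactor t (A : Matrix (Fin n ⊕ Fin n) (Fin n ⊕ Fin n) F).charpoly} ≃
      {T : (Fin n ⊕ Fin n → F) →ₗ[F] (Fin n ⊕ Fin n → F) //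
        T ∈ IsometrySet (standardForm F n) ∧ ∀ φ : S, LinearMap.ker (aeval T φ.1) = ⊥} :=
    (Equiv.subtypeSubtypeEquivSubtypeInter (· ∈ Matrix.symplecticGroup (Fin n) F)
      (fun A => HasNoSmallFactor t A.charpoly)).trans
      ((Matrix.toLin' (R := F)).toEquiv.subtypeEquiv fun A =>
        ⟨fun h => ⟨(mem_symplecticGroup_iff_toLin' A).1 h.1, (hasNoSmallFactor_iff h.1 hS hS').1 h.2⟩,
          fun h => ⟨(mem_symplecticGroup_iff_toLin' A).2 h.1,
            (hasNoSmallFactor_iff ((mem_symplecticGroup_iff_toLin' A).2 h.1) hS hS').2 h.2⟩⟩)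
  rw [Nat.card_congr e1, Nat.card_congr e2]

end CharacteristicPolynomial

/-! ### Evaluation of the local series. -/

section LocalSums

variable {F : Type u} [Field F] [Finite F]

theorem one_lt_card_pow {k : ℕ} (hk : 1 ≤ k) : (1 : ℝ) < (Nat.card F : ℝ) ^ k :=
  one_lt_pow₀ (by exact_mod_cast Finite.one_lt_card) (by omega)

theorem localSum_of_conjPoly_ne {φ : F[X]} (h : IsGoodPoly φ) (hc : conjPoly φ ≠ φ) :
    (Summable fun k => ‖moebiusWeight φ k * localCount φ k‖) ∧
      ∑' k, moebiusWeight φ k * localCount φ k =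
        ∏' i : ℕ, (1 - 1 / (Nat.card F : ℝ) ^ ((i + 1) * φ.natDegree)) := by
  have hQ := one_lt_card_pow (F := F) h.2.1.natDegree_pos
  have e : ∀ k, moebiusWeight φ k * localCount φ k =
      (-1) ^ k / qFac ((Nat.card F : ℝ) ^ φ.natDegree) k := fun k => by
    rw [localCount, if_neg hc, moebiusWeight, card_adjoinRoot h.2.1.ne_zero]
    push_cast; rw [mul_one]
  refine ⟨((summable_inv_qFac hQ (-1)).congr fun k => (e k).symm).norm, ?_⟩
  rw [tsum_congr e, tsum_neg_one_pow_div_qFac hQ]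
  exact tprod_congr fun i => by rw [← pow_mul, mul_comm]

theorem localSum_of_natDegree_eq_one {φ : F[X]} (h : IsGoodPoly φ) (hc : conjPoly φ = φ)
    (hd : φ.natDegree = 1) :
    (Summable fun k => ‖moebiusWeight φ k * localCount φ k‖) ∧
      ∑' k, moebiusWeight φ k * localCount φ k =
        ∏' i : ℕ, (1 - 1 / (Nat.card F : ℝ) ^ (2 * i + 1)) := by
  have : Fact (Irreducible φ) := ⟨h.2.1⟩
  have hq : (1 : ℝ) < Nat.card F := by exact_mod_cast Finite.one_lt_card
  have hf : formCount φ = 1 := by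
    rcases formCount_eq φ h hc with h1 | ⟨j, -, hj, -⟩
    · exact h1.2
    · omega
  have e : ∀ k, moebiusWeight φ k * localCount φ k =
      (Nat.card F : ℝ) ^ (k.choose 2) * (-1) ^ k / qFac (Nat.card F) k := fun k => by
    rw [localCount, if_pos hc, moebiusWeight, card_adjoinRoot h.2.1.ne_zero, hf, hd]
    push_cast; rw [pow_one]; ring
  refine ⟨((summable_pow_choose_div_qFac hq (by simpa using hq)).congr
    fun k => (e k).symm).norm, ?_⟩
  rw [tsum_congr e, tsum_pow_choose_one hq]

theorem localSum_of_natDegree_ne_one {φ : F[X]} (h : IsGoodPoly φ) (hc : conjPoly φ = φ)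
    (hd : φ.natDegree ≠ 1) :
    (Summable fun k => ‖moebiusWeight φ k * localCount φ k‖) ∧ ∃ j, 1 ≤ j ∧ φ.natDegree = 2 * j ∧
      ∑' k, moebiusWeight φ k * localCount φ k =
        ∏' i : ℕ, (1 + (-1) ^ (i + 1) / (Nat.card F : ℝ) ^ ((i + 1) * j)) := by
  have : Fact (Irreducible φ) := ⟨h.2.1⟩
  obtain ⟨h1, -⟩ | ⟨j, hj, hdj, hf⟩ := formCount_eq φ h hc
  · exact absurd h1 hd
  have hp := one_lt_card_pow (F := F) hj
  have e : ∀ k, moebiusWeight φ k * localCount φ k =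
      (((Nat.card F : ℝ) ^ j) ^ 2) ^ (k.choose 2) * (-(Nat.card F : ℝ) ^ j) ^ k /
        qFac (((Nat.card F : ℝ) ^ j) ^ 2) k := fun k => by
    rw [localCount, if_pos hc, moebiusWeight, card_adjoinRoot h.2.1.ne_zero, hf, hdj,
      mul_comm 2 j, pow_mul]
    push_cast
    rw [neg_pow ((Nat.card F : ℝ) ^ j)]
    ring
  refine ⟨((summable_pow_choose_div_qFac (by nlinarith) ?_).congr
    fun k => (e k).symm).norm, j, hj, hdj, ?_⟩
  · rw [abs_neg, abs_of_pos (by linarith)]; nlinarith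
  rw [tsum_congr e, tsum_pow_choose_sqrt hp]
  exact tprod_congr fun i => by rw [← pow_mul, mul_comm]

end LocalSums

/-! ### Choosing representatives of conjugate pairs and assembling the limit. -/

section Representatives

variable (F : Type u) [Field F]

/-- The self-conjugate irreducible polynomials of degree at most `t`. -/
def selfConjSet (t : ℕ) : Set F[X] := {φ | IsGoodPoly φ ∧ φ.natDegree ≤ t ∧ conjPoly φ = φ}

/-- One element of each pair of conjugate irreducible polynomials of degree at most `t`. -/
def pairRepSet (t : ℕ) : Set F[X] :=
  {φ | IsGoodPoly φ ∧ φ.natDegree ≤ t ∧ WellOrderingRel φ (conjPoly φ)}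

variable {F}

theorem conjPoly_ne_of_mem_pairRepSet {t : ℕ} {φ : F[X]} (h : φ ∈ pairRepSet F t) :
    conjPoly φ ≠ φ := fun hc => by
  have := h.2.2
  rw [hc] at this
  exact irrefl_of WellOrderingRel φ this

theorem IsGoodPoly.conjPoly_conjPoly {φ : F[X]} (h : IsGoodPoly φ) :
    _root_.conjPoly (_root_.conjPoly φ) = φ :=
  _root_.conjPoly_conjPoly h.1 h.2.2

theorem disjoint_selfConjSet_pairRepSet (t : ℕ) :
    Disjoint (selfConjSet F t) (pairRepSet F t) :=
  Set.disjoint_left.2 fun _ h1 h2 => conjPoly_ne_of_mem_pairRepSet h2 h1.2.2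

theorem mem_pairRepSet_or {t : ℕ} {φ : F[X]} (h : IsGoodPoly φ) (ht : φ.natDegree ≤ t)
    (hc : conjPoly φ ≠ φ) : φ ∈ pairRepSet F t ∨ conjPoly φ ∈ pairRepSet F t := by
  rcases trichotomous_of WellOrderingRel φ (conjPoly φ) with h1 | h1 | h1
  · exact Or.inl ⟨h, ht, h1⟩
  · exact absurd h1.symm hc
  · exact Or.inr ⟨h.conjPoly, (natDegree_conjPoly h.2.2).trans_le ht, by
      rwa [h.conjPoly_conjPoly]⟩

/-- This is the hypothesis under which distinct components are orthogonal, and the reason for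
keeping only one member of each pair. -/
theorem conjPoly_ne_of_mem_union {t : ℕ} {φ ψ : F[X]} (hφ : φ ∈ selfConjSet F t ∪ pairRepSet F t)
    (hψ : ψ ∈ selfConjSet F t ∪ pairRepSet F t) (hne : φ ≠ ψ) : conjPoly φ ≠ ψ := by
  rintro rfl
  have hg : IsGoodPoly φ := hφ.elim (fun h => h.1) (fun h => h.1)
  rcases hφ with h1 | h1
  · exact hne h1.2.2.symm
  · rcases hψ with h2 | h2
    · have := h2.2.2
      rw [hg.conjPoly_conjPoly] at this
      exact hne this
    · have := h2.2.2
      rw [hg.conjPoly_conjPoly] at this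
      exact asymm_of WellOrderingRel this h1.2.2

section Finite

variable [Finite F]

theorem finite_natDegree_le (t : ℕ) : {φ : F[X] | φ.natDegree ≤ t}.Finite := by
  refine Set.Finite.of_injOn (f := fun (φ : F[X]) (k : Fin (t + 1)) => φ.coeff k)
    (t := Set.univ) (Set.mapsTo_univ _ _) ?_ Set.finite_univ
  intro φ hφ ψ hψ h
  ext k
  rcases lt_or_ge k (t + 1) with hk | hk
  · exact congrFun h ⟨k, hk⟩
  · rw [coeff_eq_zero_of_natDegree_lt (lt_of_le_of_lt hφ hk),
      coeff_eq_zero_of_natDegree_lt (lt_of_le_of_lt hψ hk)]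

theorem finite_selfConjSet (t : ℕ) : (selfConjSet F t).Finite :=
  (finite_natDegree_le t).subset fun _ h => h.2.1

theorem finite_pairRepSet (t : ℕ) : (pairRepSet F t).Finite :=
  (finite_natDegree_le t).subset fun _ h => h.2.1

end Finite

theorem numSelfConj_eq_ncard {t j : ℕ} (hj : j ≤ t) :
    numSelfConj F j = ({φ ∈ selfConjSet F t | φ.natDegree = j} : Set F[X]).ncard := by
  rw [numSelfConj]
  congr 1
  ext φ
  constructor
  · rintro ⟨h1, h2, h3, rfl, h5⟩
    exact ⟨⟨⟨h1, h2, h3⟩, hj, h5⟩, rfl⟩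
  · rintro ⟨⟨⟨h1, h2, h3⟩, -, h5⟩, h4⟩
    exact ⟨h1, h2, h3, h4, h5⟩

theorem numConjPairs_eq_ncard {t j : ℕ} (hj : j ≤ t) :
    numConjPairs F j = ({φ ∈ pairRepSet F t | φ.natDegree = j} : Set F[X]).ncard := by
  have hinj : Set.InjOn (fun φ : F[X] => s(φ, conjPoly φ))
      {φ ∈ pairRepSet F t | φ.natDegree = j} := by
    rintro φ ⟨hφ, -⟩ ψ ⟨hψ, -⟩ h
    by_contra hne
    rcases Sym2.eq_iff.1 h with h1 | h1
    · exact hne h1.1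
    · exact conjPoly_ne_of_mem_union (Or.inr hφ) (Or.inr hψ) hne h1.2
  rw [numConjPairs, ← hinj.ncard_image]
  congr 1
  ext s
  constructor
  · rintro ⟨φ, h1, h2, h3, rfl, h5, rfl⟩
    have hg : IsGoodPoly φ := ⟨h1, h2, h3⟩
    rcases mem_pairRepSet_or hg hj h5 with h6 | h6
    · exact ⟨φ, ⟨h6, rfl⟩, rfl⟩
    · exact ⟨conjPoly φ, ⟨h6, natDegree_conjPoly h3⟩, by
        dsimp only; rw [hg.conjPoly_conjPoly, Sym2.eq_swap]⟩
  · rintro ⟨φ, ⟨hφ, hd⟩, rfl⟩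
    exact ⟨φ, hφ.1.1, hφ.1.2.1, hφ.1.2.2, hd, conjPoly_ne_of_mem_pairRepSet hφ, rfl⟩

variable [Finite F]

/-- The limit is a product over the self-conjugate polynomials and conjugate pairs. -/
theorem prod_localSum_eq_spLimit {t : ℕ} (ht : 1 ≤ t) :
    ∏ φ ∈ ((finite_selfConjSet (F := F) t).union (finite_pairRepSet t)).toFinset,
      ∑' k, moebiusWeight φ k * localCount φ k = spLimit (numSelfConj F 1) F t := by
  classical
  set A := (finite_selfConjSet (F := F) t).toFinset with hA
  set P := (finite_pairRepSet (F := F) t).toFinset with hP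
  have hmA : ∀ φ, φ ∈ A ↔ φ ∈ selfConjSet F t := fun φ => Set.Finite.mem_toFinset _
  have hmP : ∀ φ, φ ∈ P ↔ φ ∈ pairRepSet F t := fun φ => Set.Finite.mem_toFinset _
  have hu : ((finite_selfConjSet (F := F) t).union (finite_pairRepSet t)).toFinset = A ∪ P := by
    ext φ; simp [hA, hP]
  have hdis : Disjoint A P := Finset.disjoint_left.2 fun φ h1 h2 =>
    Set.disjoint_left.1 (disjoint_selfConjSet_pairRepSet t) ((hmA φ).1 h1) ((hmP φ).1 h2)
  have hcA : ∀ j ≤ t, (A.filter fun φ => φ.natDegree = j).card = numSelfConj F j := by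
    intro j hj
    rw [numSelfConj_eq_ncard hj, ← Set.ncard_coe_finset]
    congr 1; ext φ; simp [hmA]
  have hcP : ∀ j ≤ t, (P.filter fun φ => φ.natDegree = j).card = numConjPairs F j := by
    intro j hj
    rw [numConjPairs_eq_ncard hj, ← Set.ncard_coe_finset]
    congr 1; ext φ; simp [hmP]
  have hPprod : ∏ φ ∈ P, ∑' k, moebiusWeight φ k * localCount φ k =
      ∏ j ∈ Finset.Icc 1 t, ∏' i : ℕ,
        (1 - 1 / (Nat.card F : ℝ) ^ ((i + 1) * j)) ^ numConjPairs F j := by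
    rw [← Finset.prod_fiberwise_of_maps_to (t := Finset.Icc 1 t) (g := natDegree)
      (fun φ h => Finset.mem_Icc.2 ⟨((hmP φ).1 h).1.2.1.natDegree_pos, ((hmP φ).1 h).2.1⟩)]
    refine Finset.prod_congr rfl fun j hj => ?_
    rw [Finset.mem_Icc] at hj
    have hm := multipliable_spLimit_three F j 1 hj.1
    simp only [pow_one] at hm
    rw [hm.tprod_pow, ← hcP j hj.2]
    refine Finset.prod_eq_pow_card fun φ hφ => ?_
    rw [Finset.mem_filter, hmP] at hφ
    rw [(localSum_of_conjPoly_ne hφ.1.1 (conjPoly_ne_of_mem_pairRepSet hφ.1)).2, hφ.2]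
  have hA1 : ∏ φ ∈ A with φ.natDegree = 1, ∑' k, moebiusWeight φ k * localCount φ k =
      ∏' i : ℕ, (1 - 1 / (Nat.card F : ℝ) ^ (2 * i + 1)) ^ numSelfConj F 1 := by
    have hm := multipliable_spLimit_one F 1
    simp only [pow_one] at hm
    rw [hm.tprod_pow, ← hcA 1 ht]
    refine Finset.prod_eq_pow_card fun φ hφ => ?_
    rw [Finset.mem_filter, hmA] at hφ
    exact (localSum_of_natDegree_eq_one hφ.1.1 hφ.1.2.2 hφ.2).2
  have hA2 : ∏ φ ∈ A with ¬ φ.natDegree = 1, ∑' k, moebiusWeight φ k * localCount φ k =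
      ∏ j ∈ Finset.Icc 1 (t / 2), ∏' i : ℕ,
        (1 + (-1) ^ (i + 1) / (Nat.card F : ℝ) ^ ((i + 1) * j)) ^ numSelfConj F (2 * j) := by
    -- Self-conjugate polynomials of degree other than one have even degree, so half the degree is a
    -- faithful index.
    have hmaps : ∀ φ ∈ A.filter (fun φ => ¬ φ.natDegree = 1),
        φ.natDegree / 2 ∈ Finset.Icc 1 (t / 2) := by
      intro φ hφ
      rw [Finset.mem_filter, hmA] at hφ
      obtain ⟨-, j, hj, hdj, -⟩ := localSum_of_natDegree_ne_one hφ.1.1 hφ.1.2.2 hφ.2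
      have := hφ.1.2.1
      rw [Finset.mem_Icc]
      omega
    rw [← Finset.prod_fiberwise_of_maps_to hmaps]
    refine Finset.prod_congr rfl fun j hj => ?_
    rw [Finset.mem_Icc] at hj
    have hm := multipliable_spLimit_two F j 1 hj.1
    simp only [pow_one] at hm
    have hfil : (A.filter (fun φ => ¬ φ.natDegree = 1)).filter (fun φ => φ.natDegree / 2 = j) =
        A.filter fun φ => φ.natDegree = 2 * j := by
      ext φ
      simp only [Finset.mem_filter, hmA]
      constructor
      · rintro ⟨⟨h1, h2⟩, h3⟩
        obtain ⟨-, i, hi, hdi, -⟩ := localSum_of_natDegree_ne_one h1.1 h1.2.2 h2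
        exact ⟨h1, by omega⟩
      · rintro ⟨h1, h2⟩
        exact ⟨⟨h1, by omega⟩, by omega⟩
    rw [hm.tprod_pow, ← hcA (2 * j) (by omega), hfil]
    refine Finset.prod_eq_pow_card fun φ hφ => ?_
    rw [Finset.mem_filter, hmA] at hφ
    obtain ⟨-, i, hi, hdi, hsum⟩ := localSum_of_natDegree_ne_one hφ.1.1 hφ.1.2.2 (by omega)
    obtain rfl : i = j := by omega
    exact hsum
  rw [hu, Finset.prod_union hdis, hPprod, ← Finset.prod_filter_mul_prod_filter_not A
    (fun φ => φ.natDegree = 1), hA1, hA2, spLimit]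

theorem tendsto_spProportion {t : ℕ} (ht : 1 ≤ t) :
    Tendsto (fun n : ℕ => spProportion F t n) atTop (𝓝 (spLimit (numSelfConj F 1) F t)) := by
  have hfin := (finite_selfConjSet (F := F) t).union (finite_pairRepSet t)
  have hS : ∀ φ ∈ selfConjSet F t ∪ pairRepSet F t, IsGoodPoly φ ∧ φ.natDegree ≤ t :=
    fun φ hφ => hφ.elim (fun h => ⟨h.1, h.2.1⟩) (fun h => ⟨h.1, h.2.1⟩)
  have hS' : ∀ φ : F[X], IsGoodPoly φ → φ.natDegree ≤ t →
      φ ∈ selfConjSet F t ∪ pairRepSet F t ∨ conjPoly φ ∈ selfConjSet F t ∪ pairRepSet F t := by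
    intro φ h hd
    by_cases hc : conjPoly φ = φ
    · exact Or.inl (Or.inl ⟨h, hd, hc⟩)
    · exact (mem_pairRepSet_or h hd hc).imp Or.inr Or.inr
  have hsum : ∀ φ ∈ selfConjSet F t ∪ pairRepSet F t,
      Summable fun k => ‖moebiusWeight φ k * localCount φ k‖ := by
    intro φ hφ
    by_cases hc : conjPoly φ = φ
    · by_cases hd : φ.natDegree = 1
      · exact (localSum_of_natDegree_eq_one (hS φ hφ).1 hc hd).1
      · exact (localSum_of_natDegree_ne_one (hS φ hφ).1 hc hd).1
    · exact (localSum_of_conjPoly_ne (hS φ hφ).1 hc).1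
  let : Fintype (selfConjSet F t ∪ pairRepSet F t : Set F[X]) := hfin.fintype
  have : ∀ φ : (selfConjSet F t ∪ pairRepSet F t : Set F[X]), Fact (Irreducible φ.1) :=
    fun φ => ⟨(hS φ.1 φ.2).1.2.1⟩
  have h := tendsto_proportion_ker_eq_bot
    (fun φ : (selfConjSet F t ∪ pairRepSet F t : Set F[X]) => φ.1)
    (fun φ => (hS φ.1 φ.2).1) Subtype.val_injective
    (fun φ ψ hne => conjPoly_ne_of_mem_union φ.2 ψ.2 (Subtype.coe_ne_coe.2 hne))
    (fun φ => hsum φ.1 φ.2)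
  rw [← prod_localSum_eq_spLimit ht, Finset.prod_subtype (F := inferInstance) hfin.toFinset
    (p := (· ∈ selfConjSet F t ∪ pairRepSet F t)) (fun φ => hfin.mem_toFinset)]
  exact h.congr fun n => (spProportion_eq hS hS' n).symm

end Representatives

/-! ### Linear polynomials and the exponent `e`. -/

section DegreeOne

variable {F : Type u} [Field F]

theorem isGoodPoly_X_add_C {b : F} (hb : b ≠ 0) : IsGoodPoly (X + C b) :=
  ⟨monic_X_add_C b, irreducible_of_degree_eq_one (degree_X_add_C b), by simpa using hb⟩

theorem conjPoly_X_add_C {b : F} (hb : b ≠ 0) : conjPoly (X + C b) = X + C b⁻¹ := by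
  have h := isGoodPoly_X_add_C hb
  have hd : (conjPoly (X + C b)).natDegree = 1 := by
    rw [natDegree_conjPoly h.2.2, natDegree_X_add_C]
  rw [h.conjPoly.1.eq_X_add_C hd, coeff_zero_conjPoly h.1]
  simp

theorem X_add_C_injective : Function.Injective fun b : F => X + C b := fun _ _ h =>
  C_injective (add_left_cancel h)

/-- The conjugate of `X + b` is `X + b⁻¹`, so self-conjugacy means `b² = 1`; the exponent `e` is `2`
or `1` according to whether `1` and `-1` differ. -/
theorem numSelfConj_one : numSelfConj F 1 = ({1, -1} : Set F).ncard := by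
  rw [numSelfConj, ← (X_add_C_injective (F := F)).injOn.ncard_image (s := {1, -1})]
  congr 1
  ext φ
  constructor
  · rintro ⟨h1, h2, h3, h4, h5⟩
    refine ⟨φ.coeff 0, ?_, (h1.eq_X_add_C h4).symm⟩
    have h6 := coeff_zero_conjPoly h1
    rw [h5] at h6
    have h7 : φ.coeff 0 * φ.coeff 0 = 1 := by
      nth_rw 1 [h6]; exact inv_mul_cancel₀ h3
    simpa using mul_self_eq_one_iff.1 h7
  · rintro ⟨b, hb, rfl⟩
    have hb' : b * b = 1 := mul_self_eq_one_iff.2 (by simpa using hb)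
    have hb0 : b ≠ 0 := left_ne_zero_of_mul_eq_one hb'
    have hg := isGoodPoly_X_add_C hb0
    refine ⟨hg.1, hg.2.1, hg.2.2, natDegree_X_add_C b, ?_⟩
    rw [conjPoly_X_add_C hb0, inv_eq_of_mul_eq_one_left hb']

theorem numSelfConj_one_of_odd [Finite F] (h : Odd (Nat.card F)) : numSelfConj F 1 = 2 := by
  have := Fintype.ofFinite F
  rw [Nat.card_eq_fintype_card] at h
  rw [numSelfConj_one, Set.ncard_pair]
  refine (Ring.neg_one_ne_one_of_char_ne_two fun h2 => ?_).symm
  have := FiniteField.even_card_of_char_two h2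
  rw [Nat.odd_iff] at h
  omega

theorem numSelfConj_one_of_even [Finite F] (h : Even (Nat.card F)) : numSelfConj F 1 = 1 := by
  have := Fintype.ofFinite F
  rw [Nat.card_eq_fintype_card] at h
  have h2 : ringChar F = 2 := FiniteField.even_card_iff_char_two.2 (Nat.even_iff.1 h)
  have : CharP F 2 := h2 ▸ ringChar.charP F
  rw [numSelfConj_one, CharTwo.neg_eq, Set.pair_eq_singleton, Set.ncard_singleton]

/-- Each of the `q - 1` polynomials `X + b` with `b ≠ 0` is self-conjugate or belongs to one of the
pairs. -/
theorem card_le_numSelfConj_one_add [Finite F] :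
    Nat.card F ≤ 1 + numSelfConj F 1 + 2 * numConjPairs F 1 := by
  rw [numSelfConj_eq_ncard (t := 1) le_rfl, numConjPairs_eq_ncard (t := 1) le_rfl]
  set A := ({φ ∈ selfConjSet F 1 | φ.natDegree = 1} : Set F[X])
  set P := ({φ ∈ pairRepSet F 1 | φ.natDegree = 1} : Set F[X])
  have hA : A.Finite := (finite_selfConjSet 1).subset fun _ h => h.1
  have hP : P.Finite := (finite_pairRepSet 1).subset fun _ h => h.1
  have h1 : (fun b : F => X + C b) '' {0}ᶜ ⊆ A ∪ (P ∪ conjPoly '' P) := by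
    rintro _ ⟨b, hb, rfl⟩
    have hg := isGoodPoly_X_add_C (b := b) hb
    have hd := natDegree_X_add_C b
    by_cases hc : conjPoly (X + C b) = X + C b
    · exact Or.inl ⟨⟨hg, hd.le, hc⟩, hd⟩
    · refine Or.inr ((mem_pairRepSet_or hg hd.le hc).imp (fun h => ⟨h, hd⟩) fun h => ?_)
      exact ⟨_, ⟨h, (natDegree_conjPoly hg.2.2).trans hd⟩, hg.conjPoly_conjPoly⟩
  have h2 := Set.ncard_le_ncard h1 (hA.union (hP.union (hP.image _)))
  rw [X_add_C_injective.injOn.ncard_image] at h2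
  have h3 := Set.ncard_add_ncard_compl ({0} : Set F)
  rw [Set.ncard_singleton] at h3
  have h4 := Set.ncard_union_le A (P ∪ conjPoly '' P)
  have h5 := Set.ncard_union_le P (conjPoly '' P)
  have h6 := Set.ncard_image_le (f := conjPoly) hP
  omega

end DegreeOne

/-! ### Upper bounds for the numbers of polynomials. -/

section PolynomialCounts

variable {F : Type u} [Field F]

theorem coeff_of_conjPoly_eq {φ : F[X]} (hc : conjPoly φ = φ) {k : ℕ} (hk : k ≤ φ.natDegree) :
    φ.coeff k = (φ.coeff 0)⁻¹ * φ.coeff (φ.natDegree - k) := by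
  conv_lhs => rw [← hc]
  rw [conjPoly, coeff_C_mul, coeff_reverse, revAt_le hk]

variable [Finite F]

theorem numConjPairs_le {j : ℕ} : numConjPairs F j ≤ Nat.card F ^ j := by
  rw [numConjPairs_eq_ncard (t := j) le_rfl]
  have h : Set.InjOn (fun (φ : F[X]) (k : Fin j) => φ.coeff k)
      {φ ∈ pairRepSet F j | φ.natDegree = j} := by
    rintro φ ⟨hφ, hd⟩ ψ ⟨hψ, hd'⟩ h
    ext k
    rcases lt_trichotomy k j with hk | rfl | hk
    · exact congrFun h ⟨k, hk⟩
    · have h1 := hφ.1.1.coeff_natDegree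
      have h2 := hψ.1.1.coeff_natDegree
      rw [hd] at h1
      rw [hd'] at h2
      rw [h1, h2]
    · rw [coeff_eq_zero_of_natDegree_lt (by omega), coeff_eq_zero_of_natDegree_lt (by omega)]
  rw [← h.ncard_image]
  refine (Set.ncard_le_card _).trans ?_
  rw [Nat.card_fun, Nat.card_fin]

/-- The constant term is `1` or `-1`, and self-conjugacy recovers the upper coefficients from it and
the coefficients of index `1` to `j`. -/
theorem numSelfConj_two_mul_le {j : ℕ} : numSelfConj F (2 * j) ≤ 2 * Nat.card F ^ j := by
  classical
  rw [numSelfConj_eq_ncard (t := 2 * j) le_rfl]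
  have h : Set.InjOn (fun φ : F[X] => (decide (φ.coeff 0 = 1), fun k : Fin j => φ.coeff (k + 1)))
      {φ ∈ selfConjSet F (2 * j) | φ.natDegree = 2 * j} := by
    have h0 : ∀ φ : F[X], IsGoodPoly φ → conjPoly φ = φ → φ.coeff 0 = 1 ∨ φ.coeff 0 = -1 := by
      intro φ hg hc
      have h1 := coeff_zero_conjPoly hg.1
      rw [hc] at h1
      refine mul_self_eq_one_iff.1 ?_
      nth_rw 1 [h1]; exact inv_mul_cancel₀ hg.2.2
    rintro φ ⟨hφ, hd⟩ ψ ⟨hψ, hd'⟩ h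
    obtain ⟨h1, h2⟩ := Prod.mk.inj h
    have h3 : φ.coeff 0 = ψ.coeff 0 := by
      have h4 := decide_eq_decide.1 h1
      rcases h0 φ hφ.1 hφ.2.2 with h5 | h5
      · rw [h5, h4.1 h5]
      · rcases h0 ψ hψ.1 hψ.2.2 with h6 | h6
        · rw [h6, h4.2 h6]
        · rw [h5, h6]
    have hlow : ∀ k ≤ j, φ.coeff k = ψ.coeff k := by
      intro k hk
      rcases k with _ | k
      · exact h3
      · exact congrFun h2 ⟨k, hk⟩
    ext k
    rcases le_or_gt k j with hk | hk
    · exact hlow k hk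
    · rcases le_or_gt k (2 * j) with hk' | hk'
      · rw [coeff_of_conjPoly_eq hφ.2.2 (by omega), coeff_of_conjPoly_eq hψ.2.2 (by omega), hd,
          hd', h3, hlow _ (by omega)]
      · rw [coeff_eq_zero_of_natDegree_lt (by omega), coeff_eq_zero_of_natDegree_lt (by omega)]
  rw [← h.ncard_image]
  refine (Set.ncard_le_card _).trans ?_
  rw [Nat.card_prod, Nat.card_fun, Nat.card_fin, Nat.card_eq_fintype_card (α := Bool),
    Fintype.card_bool]

end PolynomialCounts

/-! ### Elementary bounds for infinite products. -/

section ProductBounds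

theorem tprod_nonneg_and_le_first {f : ℕ → ℝ} (hf : Multipliable f) (h0 : ∀ i, 0 ≤ f i)
    (h1 : ∀ i, f i ≤ 1) : 0 ≤ ∏' i, f i ∧ ∏' i, f i ≤ f 0 := by
  have h := hf.hasProd.tendsto_prod_nat
  refine ⟨ge_of_tendsto' h fun N => Finset.prod_nonneg fun i _ => h0 i,
    le_of_tendsto h ?_⟩
  filter_upwards [eventually_ge_atTop 1] with N hN
  obtain ⟨M, rfl⟩ := Nat.exists_eq_add_of_le' hN
  rw [Finset.prod_range_succ']
  exact mul_le_of_le_one_left (h0 0) (Finset.prod_le_one (fun i _ => h0 _) fun i _ => h1 _)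

/-- Individual factors may exceed `1`, but the product is the reciprocal of one whose factors `1 +
p^(-(2i+1))` are all at least `1`. -/
theorem tprod_neg_one_pow_nonneg_and_le_one {p : ℝ} (hp : 1 < p) :
    0 ≤ ∏' i : ℕ, (1 + (-1) ^ (i + 1) / p ^ (i + 1)) ∧
      ∏' i : ℕ, (1 + (-1) ^ (i + 1) / p ^ (i + 1)) ≤ 1 := by
  have hp0 : 0 < p := by linarith
  have h := tprod_one_add_odd_pow_mul_tprod (y := p⁻¹) (by positivity)
    (inv_lt_one_of_one_lt₀ hp)
  have hm : Multipliable fun i : ℕ => 1 + p⁻¹ ^ (2 * i + 1) := by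
    simpa using multipliable_one_add_mul_pow (y := p⁻¹) (by positivity)
      (inv_lt_one_of_one_lt₀ hp) (a := fun _ => 1) (by simp) (k := fun i => 2 * i + 1)
      (fun i => by omega)
  have h1 : 1 ≤ ∏' i : ℕ, (1 + p⁻¹ ^ (2 * i + 1)) :=
    ge_of_tendsto' hm.hasProd.tendsto_prod_nat fun N =>
      Finset.prod_induction _ (1 ≤ ·) (fun _ _ => one_le_mul_of_one_le_of_one_le) le_rfl
        fun i _ => le_add_of_nonneg_right (by positivity)
  have e : ∀ i : ℕ, (-1 : ℝ) ^ (i + 1) * p⁻¹ ^ (i + 1) = (-1) ^ (i + 1) / p ^ (i + 1) :=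
    fun i => by rw [inv_pow, div_eq_mul_inv]
  simp only [e] at h
  have h2 := eq_inv_of_mul_eq_one_right h
  rw [h2]
  exact ⟨inv_nonneg.2 (by linarith), inv_le_one_of_one_le₀ h1⟩

theorem exp_neg_two_mul_le_one_sub {x : ℝ} (h0 : 0 ≤ x) (h1 : x ≤ 1 / 2) :
    Real.exp (-2 * x) ≤ 1 - x := by
  have hpos : 0 < 1 - x := by linarith
  rw [← Real.le_log_iff_exp_le hpos]
  refine le_trans ?_ (Real.one_sub_inv_le_log_of_pos hpos)
  have : (1 - x)⁻¹ ≤ 1 + 2 * x := by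
    rw [inv_le_comm₀ hpos (by linarith), inv_le_iff_one_le_mul₀ (by linarith)]
    nlinarith
  linarith

/-- The geometric sum is below `1/(Q - 1) ≤ 2/Q`; the subtracted term lets the induction close. -/
theorem sum_range_one_div_pow_le {Q : ℝ} (hQ : 2 ≤ Q) (N : ℕ) :
    ∑ i ∈ Finset.range N, 1 / Q ^ (i + 1) ≤ 2 / Q - 2 / Q ^ (N + 1) := by
  have hQ0 : 0 < Q := by linarith
  induction N with
  | zero => simp
  | succ N ih =>
    rw [Finset.sum_range_succ]
    have h1 : 2 / Q ^ (N + 1 + 1) ≤ 1 / Q ^ (N + 1) := by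
      rw [pow_succ _ (N + 1), div_le_div_iff₀ (by positivity) (by positivity)]
      have : 0 < Q ^ (N + 1) := by positivity
      nlinarith
    have h2 : 2 / Q ^ (N + 1) = 1 / Q ^ (N + 1) + 1 / Q ^ (N + 1) := by ring
    linarith

/-- Apply `1 - x ≥ exp(-2x)` to each factor and sum the exponents, whose total is at least `-2 ·
2/Q`. -/
theorem exp_neg_four_div_le_tprod {Q : ℝ} (hQ : 2 ≤ Q) {f : ℕ → ℝ} (hf : Multipliable f)
    (h : ∀ i, 1 - 1 / Q ^ (i + 1) ≤ f i) : Real.exp (-4 / Q) ≤ ∏' i, f i := by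
  have hQ0 : 0 < Q := by linarith
  refine ge_of_tendsto' hf.hasProd.tendsto_prod_nat fun N => ?_
  calc Real.exp (-4 / Q) ≤ Real.exp (∑ i ∈ Finset.range N, -2 * (1 / Q ^ (i + 1))) := by
        rw [Real.exp_le_exp, ← Finset.mul_sum]
        have h1 := sum_range_one_div_pow_le hQ N
        have h2 : 0 < 2 / Q ^ (N + 1) := by positivity
        have h3 : -4 / Q = -2 * (2 / Q) := by ring
        rw [h3]
        linarith
    _ = ∏ i ∈ Finset.range N, Real.exp (-2 * (1 / Q ^ (i + 1))) := Real.exp_sum _ _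
    _ ≤ ∏ i ∈ Finset.range N, f i := by
        refine Finset.prod_le_prod (fun i _ => (Real.exp_pos _).le) fun i _ => ?_
        refine le_trans (exp_neg_two_mul_le_one_sub (by positivity) ?_) (h i)
        refine one_div_le_one_div_of_le (by norm_num) (hQ.trans ?_)
        exact le_self_pow₀ (by linarith) (Nat.succ_ne_zero i)

theorem exp_neg_le_pow {Q x c : ℝ} (hQ : 0 < Q) (h : Real.exp (-4 / Q) ≤ x) {M : ℕ}
    (hM : (M : ℝ) ≤ c * Q) : Real.exp (-4 * c) ≤ x ^ M := by
  refine le_trans ?_ (pow_le_pow_left₀ (Real.exp_pos _).le h M)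
  rw [← Real.exp_nat_mul, Real.exp_le_exp]
  have h1 : (M : ℝ) / Q ≤ c := (div_le_iff₀ hQ).2 hM
  have h2 : (M : ℝ) * (-4 / Q) = -4 * (M / Q) := by ring
  rw [h2]
  linarith

end ProductBounds

/-! ### Uniform bounds for `P(q,t)`. -/

section LimitBounds

variable {F : Type u} [Field F] [Finite F]

theorem two_le_card_pow {j : ℕ} (hj : 1 ≤ j) : (2 : ℝ) ≤ (Nat.card F : ℝ) ^ j := by
  have h : (2 : ℝ) ≤ Nat.card F := by exact_mod_cast (Finite.one_lt_card : 1 < Nat.card F)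
  exact h.trans (le_self_pow₀ (by linarith) (by omega))

theorem spLimit_eq (e t : ℕ) : spLimit e F t =
    (∏' i : ℕ, (1 - 1 / (Nat.card F : ℝ) ^ (2 * i + 1))) ^ e *
    (∏ j ∈ Finset.Icc 1 (t / 2), (∏' i : ℕ,
      (1 + (-1) ^ (i + 1) / ((Nat.card F : ℝ) ^ j) ^ (i + 1))) ^ numSelfConj F (2 * j)) *
    (∏ j ∈ Finset.Icc 1 t, (∏' i : ℕ,
      (1 - 1 / ((Nat.card F : ℝ) ^ j) ^ (i + 1))) ^ numConjPairs F j) := by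
  have h1 := multipliable_spLimit_one F 1
  simp only [pow_one] at h1
  rw [spLimit, h1.tprod_pow]
  congr 1
  · congr 1
    refine Finset.prod_congr rfl fun j hj => ?_
    have h2 := multipliable_spLimit_two F j 1 (Finset.mem_Icc.1 hj).1
    simp only [pow_one] at h2
    rw [h2.tprod_pow]
    congr 1
    exact tprod_congr fun i => by rw [← pow_mul, mul_comm j]
  · refine Finset.prod_congr rfl fun j hj => ?_
    have h2 := multipliable_spLimit_three F j 1 (Finset.mem_Icc.1 hj).1
    simp only [pow_one] at h2
    rw [h2.tprod_pow]
    congr 1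
    exact tprod_congr fun i => by rw [← pow_mul, mul_comm j]

theorem multipliable_one_sub_one_div_pow {Q : ℝ} (hQ : 1 < Q) :
    Multipliable fun i : ℕ => 1 - 1 / Q ^ (i + 1) := by
  simpa [sub_eq_add_neg, neg_div] using multipliable_one_add_div_pow hQ (-1)

theorem one_div_pow_mem_Icc {Q : ℝ} (hQ : 1 < Q) (k : ℕ) : 0 ≤ 1 / Q ^ k ∧ 1 / Q ^ k ≤ 1 :=
  ⟨by positivity, div_le_one_of_le₀ (one_le_pow₀ hQ.le) (by positivity)⟩

/-- Only the leading factor `1 - 1/q` of each degree-one product is kept, giving `(1 - 1/q)^(e + M)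
≤ exp(-(e + M)/q)` with `M = M*(q;1)`. -/
theorem spLimit_le {t : ℕ} (ht : 1 ≤ t) :
    spLimit (numSelfConj F 1) F t ≤ Real.exp (-1 / 2) := by
  have hq : (1 : ℝ) < Nat.card F := by exact_mod_cast Finite.one_lt_card
  have hq0 : (0 : ℝ) < Nat.card F := by linarith
  have hx := one_div_pow_mem_Icc hq 1
  rw [pow_one] at hx
  have b1 : 0 ≤ ∏' i : ℕ, (1 - 1 / (Nat.card F : ℝ) ^ (2 * i + 1)) ∧
      ∏' i : ℕ, (1 - 1 / (Nat.card F : ℝ) ^ (2 * i + 1)) ≤ 1 - 1 / (Nat.card F : ℝ) := by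
    have h1 := multipliable_spLimit_one F 1
    simp only [pow_one] at h1
    have := tprod_nonneg_and_le_first h1
      (fun i => by linarith [(one_div_pow_mem_Icc hq (2 * i + 1)).2])
      (fun i => by linarith [(one_div_pow_mem_Icc hq (2 * i + 1)).1])
    simpa using this
  have b3 : ∀ j ∈ Finset.Icc 1 t, 0 ≤ ∏' i : ℕ, (1 - 1 / ((Nat.card F : ℝ) ^ j) ^ (i + 1)) ∧
      ∏' i : ℕ, (1 - 1 / ((Nat.card F : ℝ) ^ j) ^ (i + 1)) ≤ 1 - 1 / (Nat.card F : ℝ) ^ j := by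
    intro j hj
    have hQ := one_lt_card_pow (F := F) (Finset.mem_Icc.1 hj).1
    have := tprod_nonneg_and_le_first (multipliable_one_sub_one_div_pow hQ)
      (fun i => by linarith [(one_div_pow_mem_Icc hQ (i + 1)).2])
      (fun i => by linarith [(one_div_pow_mem_Icc hQ (i + 1)).1])
    simpa using this
  have c2 : ∏ j ∈ Finset.Icc 1 (t / 2), (∏' i : ℕ,
      (1 + (-1) ^ (i + 1) / ((Nat.card F : ℝ) ^ j) ^ (i + 1))) ^ numSelfConj F (2 * j) ≤ 1 := by
    refine Finset.prod_le_one (fun j hj => ?_) fun j hj => ?_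
    · exact pow_nonneg (tprod_neg_one_pow_nonneg_and_le_one
        (one_lt_card_pow (F := F) (Finset.mem_Icc.1 hj).1)).1 _
    · have := tprod_neg_one_pow_nonneg_and_le_one
        (one_lt_card_pow (F := F) (Finset.mem_Icc.1 hj).1)
      exact pow_le_one₀ this.1 this.2
  have c3 : ∏ j ∈ Finset.Icc 1 t, (∏' i : ℕ,
      (1 - 1 / ((Nat.card F : ℝ) ^ j) ^ (i + 1))) ^ numConjPairs F j ≤
        (1 - 1 / (Nat.card F : ℝ)) ^ numConjPairs F 1 := by
    have h1 : 1 ∈ Finset.Icc 1 t := Finset.mem_Icc.2 ⟨le_rfl, ht⟩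
    rw [← Finset.mul_prod_erase _ _ h1]
    have b31 := b3 1 h1
    simp only [pow_one] at b31 ⊢
    refine (mul_le_of_le_one_right (pow_nonneg b31.1 _) ?_).trans
      (pow_le_pow_left₀ b31.1 b31.2 _)
    refine Finset.prod_le_one (fun j hj => pow_nonneg (b3 j (Finset.mem_of_mem_erase hj)).1 _)
      fun j hj => ?_
    have hj' := Finset.mem_of_mem_erase hj
    refine pow_le_one₀ (b3 j hj').1 ((b3 j hj').2.trans ?_)
    linarith [(one_div_pow_mem_Icc hq j).1]
  have hx1 : 0 ≤ 1 - 1 / (Nat.card F : ℝ) := by linarith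
  rw [spLimit_eq]
  calc _ ≤ (1 - 1 / (Nat.card F : ℝ)) ^ numSelfConj F 1 * 1 *
        (1 - 1 / (Nat.card F : ℝ)) ^ numConjPairs F 1 := by
        refine mul_le_mul (mul_le_mul (pow_le_pow_left₀ b1.1 b1.2 _) c2 ?_ (pow_nonneg hx1 _)) c3
          ?_ (mul_nonneg (pow_nonneg hx1 _) zero_le_one)
        · exact Finset.prod_nonneg fun j hj => pow_nonneg (tprod_neg_one_pow_nonneg_and_le_one
            (one_lt_card_pow (F := F) (Finset.mem_Icc.1 hj).1)).1 _
        · exact Finset.prod_nonneg fun j hj => pow_nonneg (b3 j hj).1 _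
    _ = (1 - 1 / (Nat.card F : ℝ)) ^ (numSelfConj F 1 + numConjPairs F 1) := by
        rw [mul_one, pow_add]
    _ ≤ Real.exp (-(1 / (Nat.card F : ℝ))) ^ (numSelfConj F 1 + numConjPairs F 1) :=
        pow_le_pow_left₀ hx1 (Real.one_sub_le_exp_neg _) _
    _ ≤ Real.exp (-1 / 2) := by
        rw [← Real.exp_nat_mul, Real.exp_le_exp]
        -- From `q ≤ 1 + e + 2M` and `e ≥ 1`; this is where the exponent `-1/2` comes from.
        have h1 : Nat.card F ≤ 2 * (numSelfConj F 1 + numConjPairs F 1) := by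
          have h2 := card_le_numSelfConj_one_add (F := F)
          have h3 : 0 < numSelfConj F 1 := by
            rw [numSelfConj_one]
            exact (Set.ncard_pos (Set.toFinite _)).2 ⟨1, by simp⟩
          omega
        have h2 : (Nat.card F : ℝ) ≤ 2 * ((numSelfConj F 1 + numConjPairs F 1 : ℕ) : ℝ) := by
          exact_mod_cast h1
        have h3 : (1 : ℝ) / 2 ≤
            ((numSelfConj F 1 + numConjPairs F 1 : ℕ) : ℝ) * (1 / (Nat.card F : ℝ)) := by
          rw [mul_one_div, div_le_div_iff₀ (by norm_num) hq0]
          linarith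
        linarith

/-- The exponents `e ≤ 2 ≤ q`, `N*(q;2j) ≤ 2 q^j` and `M*(q;j) ≤ q^j` balance the bounds `exp(-4/q)`
and `exp(-4/q^j)`, leaving `exp(-4)`, `exp(-8)` and `exp(-4)` independently of `q`. -/
theorem le_spLimit {e t : ℕ} (he : e ≤ 2) :
    Real.exp (-4) * (∏ _j ∈ Finset.Icc 1 (t / 2), Real.exp (-8)) *
      (∏ _j ∈ Finset.Icc 1 t, Real.exp (-4)) ≤ spLimit e F t := by
  have hq2 := two_le_card_pow (F := F) (j := 1) le_rfl
  rw [pow_one] at hq2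
  have hq : (1 : ℝ) < Nat.card F := by linarith
  rw [spLimit_eq]
  have b1 : Real.exp (-4) ≤ (∏' i : ℕ, (1 - 1 / (Nat.card F : ℝ) ^ (2 * i + 1))) ^ e := by
    have h1 := multipliable_spLimit_one F 1
    simp only [pow_one] at h1
    have h2 := exp_neg_four_div_le_tprod hq2 h1 fun i => by
      have : (1 : ℝ) / (Nat.card F : ℝ) ^ (2 * i + 1) ≤ 1 / (Nat.card F : ℝ) ^ (i + 1) :=
        one_div_le_one_div_of_le (by positivity) (pow_le_pow_right₀ hq.le (by omega))
      linarith
    have h3 := exp_neg_le_pow (c := 1) (M := e) (by linarith) h2 (by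
      have : (e : ℝ) ≤ 2 := by exact_mod_cast he
      linarith)
    simpa using h3
  have b2 : ∏ _j ∈ Finset.Icc 1 (t / 2), Real.exp (-8) ≤ ∏ j ∈ Finset.Icc 1 (t / 2), (∏' i : ℕ,
      (1 + (-1) ^ (i + 1) / ((Nat.card F : ℝ) ^ j) ^ (i + 1))) ^ numSelfConj F (2 * j) := by
    refine Finset.prod_le_prod (fun _ _ => (Real.exp_pos _).le) fun j hj => ?_
    have hQ := two_le_card_pow (F := F) (Finset.mem_Icc.1 hj).1
    have hm := multipliable_spLimit_aux ((Nat.card F : ℝ) ^ j) (by linarith)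
      (fun i => (-1) ^ (i + 1)) (by simp) (fun i => i + 1) (fun i => by omega) 1
    simp only [pow_one] at hm
    have h2 := exp_neg_four_div_le_tprod hQ hm fun i => by
      have h3 : (0 : ℝ) < ((Nat.card F : ℝ) ^ j) ^ (i + 1) := by positivity
      have h4 : (-1 : ℝ) ≤ (-1) ^ (i + 1) := by
        rcases neg_one_pow_eq_or ℝ (i + 1) with h | h <;> rw [h]; norm_num
      have h5 := div_le_div_of_nonneg_right h4 h3.le
      rw [neg_div] at h5
      linarith
    have h3 := exp_neg_le_pow (c := 2) (M := numSelfConj F (2 * j)) (by linarith) h2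
      (by exact_mod_cast numSelfConj_two_mul_le)
    norm_num at h3
    exact h3
  have b3 : ∏ _j ∈ Finset.Icc 1 t, Real.exp (-4) ≤ ∏ j ∈ Finset.Icc 1 t, (∏' i : ℕ,
      (1 - 1 / ((Nat.card F : ℝ) ^ j) ^ (i + 1))) ^ numConjPairs F j := by
    refine Finset.prod_le_prod (fun _ _ => (Real.exp_pos _).le) fun j hj => ?_
    have hQ := two_le_card_pow (F := F) (Finset.mem_Icc.1 hj).1
    have h2 := exp_neg_four_div_le_tprod hQ
      (multipliable_one_sub_one_div_pow (by linarith)) fun i => le_rfl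
    have h3 := exp_neg_le_pow (c := 1) (M := numConjPairs F j) (by linarith) h2
      (by rw [one_mul]; exact_mod_cast numConjPairs_le)
    simpa using h3
  have p2 : 0 ≤ ∏ _j ∈ Finset.Icc 1 (t / 2), Real.exp (-8) :=
    Finset.prod_nonneg fun _ _ => (Real.exp_pos _).le
  have p3 : 0 ≤ ∏ _j ∈ Finset.Icc 1 t, Real.exp (-4) :=
    Finset.prod_nonneg fun _ _ => (Real.exp_pos _).le
  have p1 := (Real.exp_pos (-4)).le
  exact mul_le_mul (mul_le_mul b1 b2 p2 (p1.trans b1)) b3 p3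
    (mul_nonneg (p1.trans b1) (p2.trans b2))

end LimitBounds

end

theorem mainTheorem7 :
    -- odd characteristic: the limit, and the two uniform bounds
    ((∀ t : ℕ, 1 ≤ t → ∀ (F : Type u) [Field F] [Finite F], Odd (Nat.card F) →
        Tendsto (fun n : ℕ => spProportion F t n) atTop (𝓝 (spLimit 2 F t))) ∧
      (∃ C : ℝ, C < 1 ∧ ∀ t : ℕ, 1 ≤ t → ∀ (F : Type u) [Field F] [Finite F],
        Odd (Nat.card F) → spLimit 2 F t ≤ C) ∧
      (∀ t : ℕ, 1 ≤ t → ∃ c : ℝ, 0 < c ∧ ∀ (F : Type u) [Field F] [Finite F],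
        Odd (Nat.card F) → c ≤ spLimit 2 F t)) ∧
    -- even characteristic: the limit, and the two uniform bounds
    ((∀ t : ℕ, 1 ≤ t → ∀ (F : Type u) [Field F] [Finite F], Even (Nat.card F) →
        Tendsto (fun n : ℕ => spProportion F t n) atTop (𝓝 (spLimit 1 F t))) ∧
      (∃ C : ℝ, C < 1 ∧ ∀ t : ℕ, 1 ≤ t → ∀ (F : Type u) [Field F] [Finite F],
        Even (Nat.card F) → spLimit 1 F t ≤ C) ∧
      (∀ t : ℕ, 1 ≤ t → ∃ c : ℝ, 0 < c ∧ ∀ (F : Type u) [Field F] [Finite F],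
        Even (Nat.card F) → c ≤ spLimit 1 F t)) := by
  have hC : Real.exp (-1 / 2) < 1 := by
    rw [← Real.exp_zero]
    exact Real.exp_lt_exp.2 (by norm_num)
  have hc : ∀ t : ℕ, 0 < Real.exp (-4) * (∏ _j ∈ Finset.Icc 1 (t / 2), Real.exp (-8)) *
      (∏ _j ∈ Finset.Icc 1 t, Real.exp (-4)) := fun t =>
    mul_pos (mul_pos (Real.exp_pos _) (Finset.prod_pos fun _ _ => Real.exp_pos _))
      (Finset.prod_pos fun _ _ => Real.exp_pos _)
  refine ⟨⟨fun t ht F _ _ hF => ?_, ⟨_, hC, fun t ht F _ _ hF => ?_⟩,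
    fun t _ => ⟨_, hc t, fun F _ _ _ => le_spLimit le_rfl⟩⟩,
    ⟨fun t ht F _ _ hF => ?_, ⟨_, hC, fun t ht F _ _ hF => ?_⟩,
    fun t _ => ⟨_, hc t, fun F _ _ _ => le_spLimit one_le_two⟩⟩⟩
  · have h := tendsto_spProportion (F := F) ht
    rwa [numSelfConj_one_of_odd hF] at h
  · have h := spLimit_le (F := F) ht
    rwa [numSelfConj_one_of_odd hF] at h
  · have h := tendsto_spProportion (F := F) ht
    rwa [numSelfConj_one_of_even hF] at h
  · have h := spLimit_le (F := F) ht
    rwa [numSelfConj_one_of_even hF] at h
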